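/- Let $X=(X_1,\dots,X_d)$ be an infinitely divisible random vector in $\mathbb{R}^d$ without Gaussian component, $X\sim ID(\gamma,0,\nu)$, that is, $$\mathbb{E}e^{i\langle t,X\rangle}=\exp\Big\{i\langle t,\gamma\rangle+\int_{\mathbb{R}^d}\big(e^{i\langle t,u\rangle}-1-i\langle t,u\rangle\mathbf 1_{\|u\|_2\le 1}\big)\nu(du)\Big\},\qquad t\in\mathbb{R}^d,$$ where $\gamma\in\mathbb{R}^d$ and $\nu\neq 0$ is a positive Borel measure on $\mathbb{R}^d$ with $\nu(\{0\})=0$ and $\int(1\wedge\|u\|_2^2)\,\nu(du)<\infty$. Assume that the components $X_1,\dots,X_d$ are independent, and for $k=1,\dots,d$ let $\tilde\nu_k$ be the one-dimensional Lévy measure $\tilde\nu_k(A)=\nu(\{u: u_k\in A\setminus\{0\}\})$ (independence means that $\nu$ is concentrated on the coordinate axes, and $\tilde\nu_k$ is its part on the $k$-th axis). Let $S$ be a linear subspace of $\mathbb{R}^d$, $\Pi_S$ the orthogonal projection on $S$, $e_1,\dots,e_d$ the canonical basis, and $E>0$. Let $$M=\sup\{t>0:\ \mathbb{E}e^{t|X_k|}<\infty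 \text{ for all } k=1,\dots,d\}\in[0,\infty]$$ (with $M=0$ if there is no such $t$) and, for $0\le t<M$, $$h(t)=8\max_{1\le k\le d}\int_{\mathbb{R}}|u|(e^{t|u|}-1)\,\tilde\nu_k(du)+\frac{2}{E^2}\sum_{k=1}^d\|\Pi_S e_k\|_2^4\int_{\mathbb{R}}|u|^3(e^{t|u|}-1)\,\tilde\nu_k(du).$$ Then all these integrals are finite for $0\le t<M$, and $h$ is a strictly increasing bijection from $[0,M)$ onto $[0,h(M^-))$, where $h(M^-)=\lim_{t\uparrow M}h(t)\in(0,\infty]$ if $M>0$; write $h^{-1}$ for its inverse. For all $0<x<h(M^-)$ (no $x$ if $M=0$), $\|\Pi_S X\|_2$ is integrable, $h^{-1}$ is integrable on $[0,x]$, and $$\mathbb{P}\big(\|\Pi_S X\|_2\ge \mathbb{E}\|\Pi_S X\|_2+E+x\big)\le e^{-\int_0^x h^{-1}(s)\,ds},$$ $$\mathbb{P}\big(\|\Pi_S X\|_2\le \mathbb{E}\|\Pi_S X\|_2-E-x\big)\le e^{-\int_0^x h^{-1}(s)\,ds}.$$ -/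

import Mathlib

open MeasureTheory ProbabilityTheory

/-- `ν` is a (nonzero) Lévy measure on `ℝ^d`: no atom at the origin, and
`∫ (1 ∧ ‖u‖²) ν(du) < ∞`. -/
structure IsLevyMeasure {d : ℕ} (ν : Measure (EuclideanSpace ℝ (Fin d))) : Prop where
  ne_zero : ν ≠ 0
  zero_atom : ν {0} = 0
  lintegral_lt_top : ∫⁻ u, ENNReal.ofReal (min 1 (‖u‖ ^ 2)) ∂ν < ⊤

open Classical in
/-- The Lévy–Khintchine exponent without Gaussian part,
`i⟨t,γ⟩ + ∫ (e^{i⟨t,u⟩} - 1 - i⟨t,u⟩ 1_{‖u‖ ≤ 1}) ν(du)`. -/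
noncomputable def levyExponent {d : ℕ} (γ : EuclideanSpace ℝ (Fin d))
    (ν : Measure (EuclideanSpace ℝ (Fin d))) (t : EuclideanSpace ℝ (Fin d)) : ℂ :=
  Complex.I * ((inner ℝ t γ : ℝ) : ℂ) +
    ∫ u, (Complex.exp (Complex.I * ((inner ℝ t u : ℝ) : ℂ)) - 1 -
      (if ‖u‖ ≤ 1 then Complex.I * ((inner ℝ t u : ℝ) : ℂ) else 0)) ∂ν

/-- `X ∼ ID(γ, 0, ν)` under `P`: `X` is an infinitely divisible random vector without Gaussian
component, with shift `γ` and Lévy measure `ν`. -/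
structure IsIDVector {Ω : Type*} [MeasurableSpace Ω] (P : Measure Ω) {d : ℕ}
    (X : Ω → EuclideanSpace ℝ (Fin d)) (γ : EuclideanSpace ℝ (Fin d))
    (ν : Measure (EuclideanSpace ℝ (Fin d))) : Prop where
  aemeasurable : AEMeasurable X P
  levy : IsLevyMeasure ν
  charFun_eq : ∀ t, charFun (P.map X) t = Complex.exp (levyExponent γ ν t)

/-- The one-dimensional Lévy measure `ν̃_k` on the `k`-th axis:
`ν̃_k(A) = ν {u : u_k ∈ A \ {0}}`. For a Lévy measure concentrated on the coordinate axes
this is its part on the `k`-th axis, see `axisLevyMeasure_eq`. -/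
noncomputable def axisLevyMeasure {d : ℕ} (ν : Measure (EuclideanSpace ℝ (Fin d)))
    (k : Fin d) : Measure ℝ :=
  (ν.restrict {u | u k ≠ 0}).map (fun u => u k)

/-- If `ν(dx) = ∑ k, δ₀(dx_1) ⋯ ν̃_k(dx_k) ⋯ δ₀(dx_d)` with each `ν̃_k` without atom at `0`, then
`axisLevyMeasure ν k = ν̃_k`. -/
theorem axisLevyMeasure_eq {d : ℕ} (ν : Measure (EuclideanSpace ℝ (Fin d)))
    (ν' : Fin d → Measure ℝ) (h0 : ∀ k, ν' k {0} = 0)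
    (hν : ν = Measure.sum fun k => (ν' k).map fun u : ℝ => EuclideanSpace.single k u)
    (k : Fin d) : axisLevyMeasure ν k = ν' k := by
  have hs : ∀ j : Fin d, Measurable fun u : ℝ => EuclideanSpace.single j u := fun j => by
    refine (WithLp.measurable_toLp 2 _).comp (measurable_pi_iff.2 fun i => ?_)
    by_cases h : i = j
    · subst h; simp only [Pi.single_eq_same]; exact measurable_id
    · simp [h]
  have hk : Measurable fun u : EuclideanSpace ℝ (Fin d) => u k := by fun_prop
  ext A hA
  have hne : MeasurableSet {u : EuclideanSpace ℝ (Fin d) | u k ≠ 0} :=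
    (hk (measurableSet_singleton 0)).compl
  have hB : MeasurableSet ((fun u : EuclideanSpace ℝ (Fin d) => u k) ⁻¹' A ∩
      {u : EuclideanSpace ℝ (Fin d) | u k ≠ 0}) := (hk hA).inter hne
  rw [axisLevyMeasure, Measure.map_apply hk hA, Measure.restrict_apply (hk hA), hν,
    Measure.sum_apply _ hB, tsum_eq_single k]
  · rw [Measure.map_apply (hs k) hB]
    have : (fun u : ℝ => EuclideanSpace.single k u) ⁻¹'
        ((fun u : EuclideanSpace ℝ (Fin d) => u k) ⁻¹' A ∩ {u | u k ≠ 0}) = A \ {0} := by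
      ext u; simp
    rw [this]
    exact measure_sdiff_null (h0 k)
  · intro j hj
    rw [Measure.map_apply (hs j) hB]
    have : (fun u : ℝ => EuclideanSpace.single j u) ⁻¹'
        ((fun u : EuclideanSpace ℝ (Fin d) => u k) ⁻¹' A ∩ {u | u k ≠ 0}) = ∅ := by
      ext u; simp [hj.symm]
    simp [this]

/-- `M = sup {t > 0 : ∀ k, E e^{t|X_k|} < ∞}`, possibly `∞`
(and `⊥` if there is no such `t`). -/
noncomputable def expMomentBound {Ω : Type*} [MeasurableSpace Ω] (P : Measure Ω) {d : ℕ}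
    (X : Ω → EuclideanSpace ℝ (Fin d)) : EReal :=
  sSup ((fun t : ℝ => (t : EReal)) ''
    {t | 0 < t ∧ ∀ k, Integrable (fun ω => Real.exp (t * |X ω k|)) P})

/-- The function `h(t) = 8 max_k ∫ |u| (e^{t|u|} - 1) ν̃_k(du)
  + (2 / E²) ∑_k ‖Π_S e_k‖⁴ ∫ |u|³ (e^{t|u|} - 1) ν̃_k(du)`. -/
noncomputable def hFun {d : ℕ} (ν : Measure (EuclideanSpace ℝ (Fin d)))
    (S : Submodule ℝ (EuclideanSpace ℝ (Fin d))) (E : ℝ) (t : ℝ) : ℝ :=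
  8 * (⨆ k : Fin d, ∫ u, |u| * (Real.exp (t * |u|) - 1) ∂(axisLevyMeasure ν k)) +
    2 / E ^ 2 * ∑ k : Fin d, ‖S.starProjection (EuclideanSpace.single k (1 : ℝ))‖ ^ 4 *
      ∫ u, |u| ^ 3 * (Real.exp (t * |u|) - 1) ∂(axisLevyMeasure ν k)

/-- The interval `[0, M)` of real numbers, for an extended real `M`. -/
def realIco (M : EReal) : Set ℝ := {t | 0 ≤ t ∧ (t : EReal) < M}

/-- The left limit `h(M⁻)` of a function `h` that is nondecreasing on `[0, M)`: the supremum of its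
values there, possibly `∞` (and `⊥` if `[0, M)` is empty). -/
noncomputable def leftLimOn (h : ℝ → ℝ) (M : EReal) : EReal :=
  ⨆ t ∈ realIco M, (h t : EReal)

/-- The inverse `h⁻¹` of a function `h` that is injective on `[0, M)`. -/
noncomputable def inverseOn (h : ℝ → ℝ) (M : EReal) : ℝ → ℝ :=
  Function.invFunOn h (realIco M)

/-! The proof is the entropy method for jump laws. The law of `X` is a limit of laws satisfying a
modified logarithmic Sobolev inequality: Ent(e^F) is at most the mean of e^{F(x)} ∫ φ(F(x+u) - F(x))
η(du), where φ(x) = x e^x - e^x + 1 and η ≤ 2ν. Such an inequality is elementary for a law with an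
atom at 0 (`hasMLSI_atom_add`) and tensorizes over convolutions (`HasMLSI.conv`). It therefore holds
for the binomial approximations of compound Poisson laws, and their atoms, of mass at least 1/2,
cost only the factor 2 in η ≤ 2ν.

The norm is replaced by g(y) = √(E² + ‖y‖²), which lies between ‖y‖ and ‖y‖ + E; this is the origin
of the shift E. Independence forces ν onto the axes (`IsIDVector.onAxes`), so every jump is a
multiple of some e_k. It moves g at y = Π_S x by at most |u_k| |y_k| / g(y) + u_k² ‖Π_S e_k‖² /
(2E). The squares of the coefficients y_k / g(y) sum to at most 1, which produces the maximum over k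
in h, while the second-order term produces the sum (`lintegral_mlsPhi_le`). Hence Ent(e^{tf}) ≤
(t/2) h(t) E e^{tf} for bounded f whose increments are dominated by those of g ∘ Π_S.

Since h(t)/t is nondecreasing, ∫₀ᵗ h ≤ t h(t)/2, and Herbst's argument gives log E e^{Tf} ≤ T E f +
∫₀ᵀ h (`integral_exp_le_of_entExp_le`). This bound passes to the weak limit
(`IsIDVector.integral_exp_le`). Chernoff's inequality at T = h⁻¹(x) gives the exponent T x - ∫₀ᵀ h,
which is ∫₀ˣ h⁻¹ by equality in Young's inequality (`integral_inverseOn`).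

Finiteness of h on [0, M) requires exponential moments of `X` to pass to the large jumps of ν. They
do because the approximating laws dominate, up to a constant, one large jump added to a vector in a
fixed ball (`IsIDVector.integrableOn_exp_bigJumps`). -/

/-- The entropy functional `F ↦ Ent_μ(e^F)`. -/
noncomputable def entExp {α : Type*} [MeasurableSpace α] (μ : Measure α) (F : α → ℝ) : ℝ :=
  ∫ x, F x * Real.exp (F x) ∂μ - (∫ x, Real.exp (F x) ∂μ) * Real.log (∫ x, Real.exp (F x) ∂μ)

/-- `φ(x) = x e^x - e^x + 1`, the integrand of the modified logarithmic Sobolev inequality. -/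
noncomputable def mlsPhi (x : ℝ) : ℝ := x * Real.exp x - Real.exp x + 1

theorem mlsPhi_nonneg (x : ℝ) : 0 ≤ mlsPhi x := by
  have h := Real.add_one_le_exp (-x)
  have h2 : Real.exp x * Real.exp (-x) = 1 := by rw [← Real.exp_add]; simp
  have h3 := mul_le_mul_of_nonneg_left h (Real.exp_pos x).le
  unfold mlsPhi; nlinarith

theorem mlsPhi_zero : mlsPhi 0 = 0 := by simp [mlsPhi]

/-- The bound is monotone in |x|, so only the size of an increment of F matters afterwards. For x ≥
0 it is e^x ≥ 1 + x; for x ≤ 0 the two sides are separated by x². -/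
theorem mlsPhi_le (x : ℝ) : mlsPhi x ≤ |x| * (Real.exp |x| - 1) := by
  unfold mlsPhi
  rcases le_total 0 x with h | h
  · rw [abs_of_nonneg h]
    linarith [Real.add_one_le_exp x]
  · rw [abs_of_nonpos h]
    have h1 := Real.add_one_le_exp x
    have h2 := Real.add_one_le_exp (-x)
    nlinarith

@[fun_prop]
theorem measurable_mlsPhi : Measurable mlsPhi := by unfold mlsPhi; fun_prop

/-! ### Subadditivity and nonnegativity of entropy -/

section Entropy

variable {α β : Type*} [MeasurableSpace α] [MeasurableSpace β]

theorem integrable_of_bounded {μ : Measure α} [IsFiniteMeasure μ] {f : α → ℝ} (hf : Measurable f)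
    {C : ℝ} (hC : ∀ x, |f x| ≤ C) : Integrable f μ :=
  Integrable.of_bound hf.aestronglyMeasurable C (Filter.Eventually.of_forall hC)

theorem abs_exp_le {x C : ℝ} (h : |x| ≤ C) : |Real.exp x| ≤ Real.exp C := by
  rw [abs_of_pos (Real.exp_pos x)]
  exact Real.exp_le_exp.2 ((le_abs_self x).trans h)

theorem integral_exp_mem_Icc {μ : Measure α} [IsProbabilityMeasure μ] {F : α → ℝ}
    (hF : Measurable F) {C : ℝ} (hC : ∀ x, |F x| ≤ C) :
    ∫ x, Real.exp (F x) ∂μ ∈ Set.Icc (Real.exp (-C)) (Real.exp C) := by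
  have hi : Integrable (fun x => Real.exp (F x)) μ :=
    integrable_of_bounded (by fun_prop) fun x => abs_exp_le (hC x)
  constructor
  · have := integral_mono (μ := μ) (integrable_const (Real.exp (-C))) hi
      (fun x => Real.exp_le_exp.2 (abs_le.1 (hC x)).1)
    simpa using this
  · have := integral_mono (μ := μ) hi (integrable_const (Real.exp C))
      (fun x => Real.exp_le_exp.2 (abs_le.1 (hC x)).2)
    simpa using this

theorem abs_log_le_of_mem_Icc {a C : ℝ} (h : a ∈ Set.Icc (Real.exp (-C)) (Real.exp C)) :
    |Real.log a| ≤ C := by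
  have ha : 0 < a := (Real.exp_pos _).trans_le h.1
  exact abs_le.2 ⟨(Real.le_log_iff_exp_le ha).2 h.1, (Real.log_le_iff_le_exp ha).2 h.2⟩

theorem abs_le_of_mem_Icc_exp {a C : ℝ} (h : a ∈ Set.Icc (Real.exp (-C)) (Real.exp C)) :
    |a| ≤ Real.exp C := by
  rw [abs_of_pos ((Real.exp_pos _).trans_le h.1)]
  exact h.2

theorem abs_mul_le_mul {a b A B : ℝ} (ha : |a| ≤ A) (hb : |b| ≤ B) : |a * b| ≤ A * B := by
  rw [abs_mul]
  exact mul_le_mul ha hb (abs_nonneg _) ((abs_nonneg _).trans ha)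

/-- Subadditivity of entropy over a product of two probability spaces. -/
theorem entExp_prod_le (μ : Measure α) (ν : Measure β) [IsProbabilityMeasure μ]
    [IsProbabilityMeasure ν] {F : α × β → ℝ} (hF : Measurable F) {C : ℝ} (hC : ∀ z, |F z| ≤ C) :
    entExp (μ.prod ν) F ≤
      ∫ y, entExp μ (fun x => F (x, y)) ∂ν + ∫ x, entExp ν (fun y => F (x, y)) ∂μ := by
  set A : β → ℝ := fun y => ∫ x, Real.exp (F (x, y)) ∂μ with hA
  set B : α → ℝ := fun x => ∫ y, Real.exp (F (x, y)) ∂ν with hB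
  set m : ℝ := ∫ z, Real.exp (F z) ∂(μ.prod ν) with hm
  have hAb : ∀ y, A y ∈ Set.Icc (Real.exp (-C)) (Real.exp C) := fun y =>
    integral_exp_mem_Icc (by fun_prop) fun x => hC (x, y)
  have hBb : ∀ x, B x ∈ Set.Icc (Real.exp (-C)) (Real.exp C) := fun x =>
    integral_exp_mem_Icc (by fun_prop) fun y => hC (x, y)
  have hmb : m ∈ Set.Icc (Real.exp (-C)) (Real.exp C) := integral_exp_mem_Icc hF hC
  have hmpos : 0 < m := (Real.exp_pos _).trans_le hmb.1
  have hAm : Measurable A :=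
    (StronglyMeasurable.integral_prod_left' (μ := μ) (f := fun z : α × β => Real.exp (F z))
      (by fun_prop : Measurable _).stronglyMeasurable).measurable
  have hBm : Measurable B :=
    (StronglyMeasurable.integral_prod_right' (ν := ν) (f := fun z : α × β => Real.exp (F z))
      (by fun_prop : Measurable _).stronglyMeasurable).measurable
  have hEF : Measurable fun z => Real.exp (F z) := by fun_prop
  have iE : Integrable (fun z => Real.exp (F z)) (μ.prod ν) :=
    integrable_of_bounded hEF fun z => abs_exp_le (hC z)
  have iFE : Integrable (fun z => F z * Real.exp (F z)) (μ.prod ν) :=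
    integrable_of_bounded (hF.mul hEF) fun z => abs_mul_le_mul (hC z) (abs_exp_le (hC z))
  have iEA : Integrable (fun z : α × β => Real.exp (F z) * Real.log (A z.2)) (μ.prod ν) :=
    integrable_of_bounded (by fun_prop) fun z =>
      abs_mul_le_mul (abs_exp_le (hC z)) (abs_log_le_of_mem_Icc (hAb z.2))
  have iEB : Integrable (fun z : α × β => Real.exp (F z) * Real.log (B z.1)) (μ.prod ν) :=
    integrable_of_bounded (by fun_prop) fun z =>
      abs_mul_le_mul (abs_exp_le (hC z)) (abs_log_le_of_mem_Icc (hBb z.1))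
  have iBA : Integrable (fun z : α × β => B z.1 * A z.2) (μ.prod ν) :=
    integrable_of_bounded (by fun_prop) fun z =>
      abs_mul_le_mul (abs_le_of_mem_Icc_exp (hBb z.1)) (abs_le_of_mem_Icc_exp (hAb z.2))
  have eA : ∫ z, Real.exp (F z) * Real.log (A z.2) ∂(μ.prod ν) = ∫ y, A y * Real.log (A y) ∂ν := by
    rw [integral_prod_symm _ iEA]
    simp only [integral_mul_const, hA]
  have eB : ∫ z, Real.exp (F z) * Real.log (B z.1) ∂(μ.prod ν) = ∫ x, B x * Real.log (B x) ∂μ := by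
    rw [integral_prod _ iEB]
    simp only [integral_mul_const, hB]
  have eBA : ∫ z, B z.1 * A z.2 ∂(μ.prod ν) = m * m := by
    rw [integral_prod_mul B A]
    congr 1
    · rw [hm, integral_prod _ iE]
    · rw [hm, integral_prod_symm _ iE]
  -- The integrand is e^F (e^w - 1 - w) ≥ 0 with w = log(A B / m) - F. Both e^F and B A / m have
  -- integral m, so these terms cancel and only the entropies remain.
  have key : 0 ≤ ∫ z, (F z * Real.exp (F z) - Real.exp (F z) * Real.log (A z.2)
      - Real.exp (F z) * Real.log (B z.1) + Real.exp (F z) * Real.log m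
      - Real.exp (F z) + B z.1 * A z.2 / m) ∂(μ.prod ν) := by
    refine integral_nonneg fun z => ?_
    have pA : 0 < A z.2 := (Real.exp_pos _).trans_le (hAb z.2).1
    have pB : 0 < B z.1 := (Real.exp_pos _).trans_le (hBb z.1).1
    have h1 := Real.add_one_le_exp (Real.log (A z.2) + Real.log (B z.1) - Real.log m - F z)
    rw [Real.exp_sub, Real.exp_sub, Real.exp_add, Real.exp_log pA, Real.exp_log pB,
      Real.exp_log hmpos] at h1
    have h2 := mul_le_mul_of_nonneg_left h1 (Real.exp_pos (F z)).le
    rw [mul_div_cancel₀ _ (Real.exp_pos (F z)).ne'] at h2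
    simp only [Pi.zero_apply]
    rw [mul_comm (B z.1)]
    linarith
  rw [integral_add (by fun_prop) (by fun_prop), integral_sub (by fun_prop) (by fun_prop),
    integral_add (by fun_prop) (by fun_prop), integral_sub (by fun_prop) (by fun_prop),
    integral_sub (by fun_prop) (by fun_prop), eA, eB, integral_mul_const,
    integral_div, eBA, ← hm, mul_div_assoc, div_self hmpos.ne'] at key
  have iA : Integrable (fun y => A y * Real.log (A y)) ν :=
    integrable_of_bounded (by fun_prop) fun y =>
      abs_mul_le_mul (abs_le_of_mem_Icc_exp (hAb y)) (abs_log_le_of_mem_Icc (hAb y))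
  have iB : Integrable (fun y => B y * Real.log (B y)) μ :=
    integrable_of_bounded (by fun_prop) fun y =>
      abs_mul_le_mul (abs_le_of_mem_Icc_exp (hBb y)) (abs_log_le_of_mem_Icc (hBb y))
  have e1 : ∫ y, entExp μ (fun x => F (x, y)) ∂ν
      = ∫ z, F z * Real.exp (F z) ∂(μ.prod ν) - ∫ y, A y * Real.log (A y) ∂ν := by
    rw [integral_prod_symm _ iFE, ← integral_sub iFE.integral_prod_right iA]
    rfl
  have e2 : ∫ x, entExp ν (fun y => F (x, y)) ∂μ
      = ∫ z, F z * Real.exp (F z) ∂(μ.prod ν) - ∫ x, B x * Real.log (B x) ∂μ := by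
    rw [integral_prod _ iFE, ← integral_sub iFE.integral_prod_left iB]
    rfl
  rw [e1, e2, entExp, ← hm]
  linarith

theorem measurable_entExp_left (μ : Measure α) [SFinite μ] {F : α × β → ℝ} (hF : Measurable F) :
    Measurable fun y => entExp μ (fun x => F (x, y)) := by
  have h1 : Measurable fun y => ∫ x, Real.exp (F (x, y)) ∂μ :=
    (StronglyMeasurable.integral_prod_left' (μ := μ) (f := fun z : α × β => Real.exp (F z))
      (by fun_prop : Measurable _).stronglyMeasurable).measurable
  have h2 : Measurable fun y => ∫ x, F (x, y) * Real.exp (F (x, y)) ∂μ :=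
    (StronglyMeasurable.integral_prod_left' (μ := μ) (f := fun z : α × β => F z * Real.exp (F z))
      (by fun_prop : Measurable _).stronglyMeasurable).measurable
  unfold entExp
  fun_prop

theorem entExp_nonneg (μ : Measure α) [IsProbabilityMeasure μ] {F : α → ℝ} (hF : Measurable F)
    {C : ℝ} (hC : ∀ z, |F z| ≤ C) : 0 ≤ entExp μ F := by
  have hEF : Measurable fun z => Real.exp (F z) := by fun_prop
  have iE : Integrable (fun z => Real.exp (F z)) μ :=
    integrable_of_bounded hEF fun z => abs_exp_le (hC z)
  have iFE : Integrable (fun z => F z * Real.exp (F z)) μ :=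
    integrable_of_bounded (hF.mul hEF) fun z => abs_mul_le_mul (hC z) (abs_exp_le (hC z))
  have hmb := integral_exp_mem_Icc (μ := μ) hF hC
  set m := ∫ x, Real.exp (F x) ∂μ with hm
  have hmpos : 0 < m := (Real.exp_pos _).trans_le hmb.1
  have key : 0 ≤ ∫ z, (F z * Real.exp (F z) - Real.exp (F z) * Real.log m
      - Real.exp (F z) + m) ∂μ := by
    refine integral_nonneg fun z => ?_
    have h1 := Real.add_one_le_exp (Real.log m - F z)
    rw [Real.exp_sub, Real.exp_log hmpos] at h1
    have h2 := mul_le_mul_of_nonneg_left h1 (Real.exp_pos (F z)).le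
    rw [mul_div_cancel₀ _ (Real.exp_pos (F z)).ne'] at h2
    simp only [Pi.zero_apply]
    linarith
  rw [integral_add (by fun_prop) (by fun_prop), integral_sub (by fun_prop) (by fun_prop),
    integral_sub (by fun_prop) (by fun_prop), integral_mul_const, ← hm] at key
  simp only [integral_const, probReal_univ, smul_eq_mul, one_mul] at key
  rw [entExp, ← hm]
  linarith

end Entropy

/-! ### The modified logarithmic Sobolev inequality and its stability under convolution -/

section ModifiedLogSobolev

variable {G : Type*} [AddCommMonoid G] [MeasurableSpace G]

/-- The right-hand side of the modified logarithmic Sobolev inequality. -/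
noncomputable def mlsEnergy (μ η : Measure G) (F : G → ℝ) : ENNReal :=
  ∫⁻ x, ENNReal.ofReal (Real.exp (F x)) *
    ∫⁻ u, ENNReal.ofReal (mlsPhi (F (x + u) - F x)) ∂η ∂μ

/-- The modified logarithmic Sobolev inequality for `μ` with jump measure `η`, on bounded
measurable functions. -/
def HasMLSI (μ η : Measure G) : Prop :=
  ∀ F : G → ℝ, Measurable F → (∃ C, ∀ x, |F x| ≤ C) →
    ENNReal.ofReal (entExp μ F) ≤ mlsEnergy μ η F

/-- A deterministic summand has neither entropy nor jumps. This serves for the drift and for the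
zeroth convolution power. -/
theorem hasMLSI_dirac (b : G) : HasMLSI (Measure.dirac b) 0 := by
  rintro F hF -
  have : entExp (Measure.dirac b) F = 0 := by
    unfold entExp
    rw [integral_dirac' _ _ (by fun_prop : Measurable _).stronglyMeasurable,
      integral_dirac' _ _ (by fun_prop : Measurable _).stronglyMeasurable, Real.log_exp]
    ring
  simp [this]

variable [MeasurableAdd₂ G]

theorem entExp_conv (μ ν : Measure G) [SFinite μ] [SFinite ν] {F : G → ℝ} (hF : Measurable F) :
    entExp (μ.conv ν) F = entExp (μ.prod ν) (fun z => F (z.1 + z.2)) := by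
  unfold entExp Measure.conv
  rw [integral_map (by fun_prop) (by fun_prop), integral_map (by fun_prop) (by fun_prop)]

theorem measurable_mlsPhi_lintegral (η : Measure G) [SFinite η] {F : G → ℝ} (hF : Measurable F) :
    Measurable fun x => ∫⁻ u, ENNReal.ofReal (mlsPhi (F (x + u) - F x)) ∂η :=
  Measurable.lintegral_prod_right' (f := fun z : G × G =>
    ENNReal.ofReal (mlsPhi (F (z.1 + z.2) - F z.1))) (by fun_prop)

/-- Apply subadditivity to F(x + y) and the two inequalities to translates of F. A jump added to
either summand displaces x + y in the same way, so the jump measures add. -/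
theorem HasMLSI.conv {μ₁ μ₂ η₁ η₂ : Measure G} [IsProbabilityMeasure μ₁] [IsProbabilityMeasure μ₂]
    [SFinite η₁] [SFinite η₂] (h₁ : HasMLSI μ₁ η₁) (h₂ : HasMLSI μ₂ η₂) :
    HasMLSI (μ₁.conv μ₂) (η₁ + η₂) := by
  rintro F hF ⟨C, hC⟩
  have hF1 : ∀ y, Measurable fun x => F (x + y) := fun y => by fun_prop
  have hF2 : ∀ x, Measurable fun y => F (x + y) := fun x => by fun_prop
  have m1 : Measurable fun y => entExp μ₁ fun x => F (x + y) :=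
    measurable_entExp_left μ₁ (F := fun z : G × G => F (z.1 + z.2)) (by fun_prop)
  have m2 : Measurable fun x => entExp μ₂ fun y => F (x + y) := by
    simpa [add_comm] using
      measurable_entExp_left μ₂ (F := fun z : G × G => F (z.1 + z.2)) (by fun_prop)
  have I1 := measurable_mlsPhi_lintegral η₁ hF
  have I2 := measurable_mlsPhi_lintegral η₂ hF
  have hsub := entExp_prod_le μ₁ μ₂ (F := fun z : G × G => F (z.1 + z.2)) (by fun_prop)
    (fun z => hC _)
  calc ENNReal.ofReal (entExp (μ₁.conv μ₂) F)
      ≤ ENNReal.ofReal (∫ y, entExp μ₁ (fun x => F (x + y)) ∂μ₂)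
        + ENNReal.ofReal (∫ x, entExp μ₂ (fun y => F (x + y)) ∂μ₁) := by
        rw [entExp_conv μ₁ μ₂ hF]
        exact (ENNReal.ofReal_le_ofReal hsub).trans ENNReal.ofReal_add_le
    _ ≤ ∫⁻ y, ENNReal.ofReal (entExp μ₁ (fun x => F (x + y))) ∂μ₂
        + ∫⁻ x, ENNReal.ofReal (entExp μ₂ (fun y => F (x + y))) ∂μ₁ := by
        refine add_le_add ?_ ?_
        · rw [integral_eq_lintegral_of_nonneg_ae
            (Filter.Eventually.of_forall fun y => entExp_nonneg μ₁ (hF1 y) fun x => hC _)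
            m1.aestronglyMeasurable]
          exact ENNReal.ofReal_toReal_le
        · rw [integral_eq_lintegral_of_nonneg_ae
            (Filter.Eventually.of_forall fun x => entExp_nonneg μ₂ (hF2 x) fun y => hC _)
            m2.aestronglyMeasurable]
          exact ENNReal.ofReal_toReal_le
    _ ≤ ∫⁻ y, mlsEnergy μ₁ η₁ (fun x => F (x + y)) ∂μ₂
        + ∫⁻ x, mlsEnergy μ₂ η₂ (fun y => F (x + y)) ∂μ₁ :=
        add_le_add (lintegral_mono fun y => h₁ _ (hF1 y) ⟨C, fun x => hC _⟩)
          (lintegral_mono fun x => h₂ _ (hF2 x) ⟨C, fun y => hC _⟩)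
    _ = mlsEnergy (μ₁.conv μ₂) (η₁ + η₂) F := by
        have e1 : ∫⁻ y, mlsEnergy μ₁ η₁ (fun x => F (x + y)) ∂μ₂ =
            mlsEnergy (μ₁.conv μ₂) η₁ F := by
          rw [Measure.conv_comm]
          unfold mlsEnergy
          rw [Measure.lintegral_conv (by fun_prop)]
          simp only [add_comm, add_left_comm]
        have e2 : ∫⁻ x, mlsEnergy μ₂ η₂ (fun y => F (x + y)) ∂μ₁ =
            mlsEnergy (μ₁.conv μ₂) η₂ F := by
          unfold mlsEnergy
          rw [Measure.lintegral_conv (by fun_prop)]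
          simp only [add_assoc]
        rw [e1, e2]
        unfold mlsEnergy
        rw [← lintegral_add_left (by fun_prop)]
        simp only [lintegral_add_measure, mul_add]

/-- The modified logarithmic Sobolev inequality for a law with an atom at the origin. -/
theorem hasMLSI_atom_add (a : ENNReal) (ha : a ≠ 0) (σ : Measure G)
    [IsProbabilityMeasure (a • Measure.dirac 0 + σ)] :
    HasMLSI (a • Measure.dirac 0 + σ) (a⁻¹ • σ) := by
  rintro F hF ⟨C, hC⟩
  have hatop : a ≠ ⊤ := by
    intro h
    have := measure_univ (μ := a • Measure.dirac (0 : G) + σ)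
    simp [h] at this
  set μ := a • Measure.dirac 0 + σ with hμ
  have hEF : Measurable fun z => Real.exp (F z) := by fun_prop
  have iE : Integrable (fun z => Real.exp (F z)) μ :=
    integrable_of_bounded hEF fun z => abs_exp_le (hC z)
  have iFE : Integrable (fun z => F z * Real.exp (F z)) μ :=
    integrable_of_bounded (hF.mul hEF) fun z => abs_mul_le_mul (hC z) (abs_exp_le (hC z))
  have hmb := integral_exp_mem_Icc (μ := μ) hF hC
  have hphim : Measurable fun x => Real.exp (F 0) * mlsPhi (F x - F 0) := by fun_prop
  -- Entropy is at most ∫ (F e^F - e^F log c - e^F + c) for every c > 0. With c = e^{F(0)} the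
  -- integrand becomes e^{F(0)} φ(F(x) - F(0)), to which the atom at 0 contributes nothing because
  -- φ(0) = 0.
  have hle : entExp μ F ≤ ∫ x, Real.exp (F 0) * mlsPhi (F x - F 0) ∂μ := by
    set m := ∫ x, Real.exp (F x) ∂μ with hm
    have hmpos : 0 < m := (Real.exp_pos _).trans_le hmb.1
    have e : ∀ x, Real.exp (F 0) * mlsPhi (F x - F 0) =
        F x * Real.exp (F x) - Real.exp (F x) * (F 0 + 1) + Real.exp (F 0) := fun x => by
      have : Real.exp (F 0) * Real.exp (F x - F 0) = Real.exp (F x) := by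
        rw [← Real.exp_add]; ring_nf
      unfold mlsPhi
      linear_combination (F x - F 0 - 1) * this
    simp only [e]
    rw [integral_add (by fun_prop) (by fun_prop), integral_sub (by fun_prop) (by fun_prop),
      integral_mul_const, ← hm, entExp, ← hm]
    simp only [integral_const, probReal_univ, smul_eq_mul, one_mul]
    have h1 := Real.add_one_le_exp (F 0 - Real.log m)
    rw [Real.exp_sub, Real.exp_log hmpos] at h1
    have h2 := mul_le_mul_of_nonneg_left h1 hmpos.le
    rw [mul_div_cancel₀ _ hmpos.ne'] at h2
    linarith
  have hlin : ENNReal.ofReal (∫ x, Real.exp (F 0) * mlsPhi (F x - F 0) ∂μ) ≤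
      ENNReal.ofReal (Real.exp (F 0)) * ∫⁻ u, ENNReal.ofReal (mlsPhi (F u - F 0)) ∂σ := by
    rw [integral_eq_lintegral_of_nonneg_ae (Filter.Eventually.of_forall fun x =>
      mul_nonneg (Real.exp_pos _).le (mlsPhi_nonneg _)) hphim.aestronglyMeasurable]
    refine ENNReal.ofReal_toReal_le.trans ?_
    rw [hμ, lintegral_add_measure, lintegral_smul_measure, lintegral_dirac' _ (by fun_prop)]
    simp only [ENNReal.ofReal_mul (Real.exp_pos (F 0)).le, sub_self, mlsPhi_zero,
      ENNReal.ofReal_zero, mul_zero, smul_zero, zero_add]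
    rw [lintegral_const_mul _ (by fun_prop)]
  refine (ENNReal.ofReal_le_ofReal hle).trans (hlin.trans ?_)
  rw [mlsEnergy]
  -- Only the part of the energy carried by the base point x = 0 is kept; its weight a cancels the
  -- factor a⁻¹ of the jump measure.
  refine le_trans ?_ (lintegral_mono' (le_add_of_nonneg_right (Measure.zero_le σ)) le_rfl)
  have hmeas : Measurable fun x => ENNReal.ofReal (Real.exp (F x)) *
      ∫⁻ u, ENNReal.ofReal (mlsPhi (F (x + u) - F x)) ∂(a⁻¹ • σ) := by
    have : IsFiniteMeasure σ := by
      refine isFiniteMeasure_of_le μ ?_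
      rw [hμ]
      exact le_add_of_nonneg_left (Measure.zero_le _)
    simp only [lintegral_smul_measure, smul_eq_mul]
    have := measurable_mlsPhi_lintegral σ hF
    fun_prop
  rw [lintegral_smul_measure, lintegral_dirac' _ hmeas, lintegral_smul_measure]
  simp only [zero_add, smul_eq_mul]
  rw [mul_left_comm a, ← mul_assoc a, ENNReal.mul_inv_cancel ha hatop, one_mul]

/-- Convolution powers of a measure. -/
noncomputable def convPow (μ : Measure G) : ℕ → Measure G
  | 0 => Measure.dirac 0
  | n + 1 => (convPow μ n).conv μ

instance (μ : Measure G) [IsProbabilityMeasure μ] (n : ℕ) :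
    IsProbabilityMeasure (convPow μ n) := by
  induction n with
  | zero => unfold convPow; infer_instance
  | succ n ih => unfold convPow; infer_instance

theorem HasMLSI.conv_pow {μ η : Measure G} [IsProbabilityMeasure μ] [SFinite η]
    (h : HasMLSI μ η) (n : ℕ) : HasMLSI (convPow μ n) ((n : ENNReal) • η) := by
  induction n with
  | zero => simpa [convPow] using hasMLSI_dirac (0 : G)
  | succ n ih =>
    rw [Nat.cast_succ, add_smul, one_smul]
    exact ih.conv h

end ModifiedLogSobolev

/-! ### Herbst's argument -/

section Herbst

variable {α : Type*} [MeasurableSpace α]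

theorem integrable_exp_mul_of_bounded {μ : Measure α} [IsFiniteMeasure μ] {f : α → ℝ}
    (hf : Measurable f) {C : ℝ} (hC : ∀ x, |f x| ≤ C) (t : ℝ) :
    Integrable (fun x => Real.exp (t * f x)) μ :=
  integrable_of_bounded (by fun_prop) fun x =>
    abs_exp_le (C := |t| * C) (by rw [abs_mul]; gcongr; exact hC x)

theorem hasDerivAt_integral_of_continuousOn {h : ℝ → ℝ} {T : ℝ} (hc : ContinuousOn h (Set.Icc 0 T))
    {t : ℝ} (ht : t ∈ Set.Ioo 0 T) : HasDerivAt (fun t => ∫ s in (0 : ℝ)..t, h s) (h t) t := by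
  refine intervalIntegral.integral_hasDerivAt_right ?_ ?_ ?_
  · refine (hc.mono ?_).intervalIntegrable
    rw [Set.uIcc_of_le ht.1.le]
    exact Set.Icc_subset_Icc_right ht.2.le
  · exact ContinuousOn.stronglyMeasurableAtFilter isOpen_Ioo (hc.mono Set.Ioo_subset_Icc_self) t ht
  · exact hc.continuousAt (Icc_mem_nhds ht.1 ht.2)

/-- Herbst's argument, in a form suited to the modified logarithmic Sobolev inequality. -/
theorem integral_exp_le_of_entExp_le {μ : Measure α} [IsProbabilityMeasure μ] {f : α → ℝ}
    (hf : Measurable f) {C : ℝ} (hC : ∀ x, |f x| ≤ C) {h : ℝ → ℝ} {T : ℝ} (hT : 0 < T)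
    (hc : ContinuousOn h (Set.Icc 0 T)) (h0 : ∀ t ∈ Set.Icc 0 T, 0 ≤ h t)
    (hG : ∀ t ∈ Set.Icc 0 T, ∫ s in (0 : ℝ)..t, h s ≤ t * h t / 2)
    (hent : ∀ t ∈ Set.Ioo 0 T,
      entExp μ (fun x => t * f x) ≤ t / 2 * h t * ∫ x, Real.exp (t * f x) ∂μ) :
    ∫ x, Real.exp (T * f x) ∂μ ≤ Real.exp (T * ∫ x, f x ∂μ + ∫ s in (0 : ℝ)..T, h s) := by
  have hexp := integrable_exp_mul_of_bounded (μ := μ) hf hC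
  have hset : integrableExpSet f μ = Set.univ := Set.eq_univ_of_forall hexp
  have hmem : ∀ t, t ∈ interior (integrableExpSet f μ) := fun t => by rw [hset]; simp
  have hpos : ∀ t, 0 < mgf f μ t := fun t => mgf_pos (hexp t)
  have hdΛ : ∀ t, HasDerivAt (cgf f μ) (deriv (cgf f μ) t) t := fun t =>
    (analyticAt_cgf (hmem t)).differentiableAt.hasDerivAt
  set G : ℝ → ℝ := fun t => ∫ s in (0 : ℝ)..t, h s with hGdef
  have hcG : ContinuousOn G (Set.Icc 0 T) := by
    have := intervalIntegral.continuousOn_primitive_interval (μ := volume) (f := h) (a := 0)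
      (b := T) (by rw [Set.uIcc_of_le hT.le]; exact hc.integrableOn_Icc)
    rwa [Set.uIcc_of_le hT.le] at this
  have hGpos : ∀ t ∈ Set.Icc 0 T, 0 ≤ G t := fun t ht =>
    intervalIntegral.integral_nonneg ht.1 fun s hs => h0 s ⟨hs.1, hs.2.trans ht.2⟩
  -- With Λ the cumulant generating function, t² q' = (tΛ' - Λ) - (t h - G). The entropy bound makes
  -- the first bracket at most t h / 2, and G ≤ t h / 2 makes the second at least t h / 2. So q
  -- decreases, and near 0 it lies below Λ(s)/s, which tends to the mean of f.
  set q : ℝ → ℝ := fun t => (cgf f μ t - G t) / t with hq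
  have hdq : ∀ t ∈ Set.Ioo 0 T,
      HasDerivAt q (((deriv (cgf f μ) t - h t) * t - (cgf f μ t - G t) * 1) / t ^ 2) t :=
    fun t ht => ((hdΛ t).sub (hasDerivAt_integral_of_continuousOn hc ht)).div (hasDerivAt_id t)
      ht.1.ne'
  have hanti : AntitoneOn q (Set.Ioc 0 T) := by
    refine antitoneOn_of_deriv_nonpos (convex_Ioc 0 T) ?_ ?_ ?_
    · refine ContinuousOn.div (ContinuousOn.sub (fun t _ => (hdΛ t).continuousAt.continuousWithinAt)
        (hcG.mono Set.Ioc_subset_Icc_self)) continuousOn_id fun t ht => ht.1.ne'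
    · rw [interior_Ioc]
      exact fun t ht => (hdq t ht).differentiableAt.differentiableWithinAt
    · rw [interior_Ioc]
      intro t ht
      rw [(hdq t ht).deriv]
      refine div_nonpos_of_nonpos_of_nonneg ?_ (by positivity)
      have h1 := hent t ht
      have h2 := hG t (Set.Ioo_subset_Icc_self ht)
      rw [deriv_cgf (hmem t)]
      have e1 : entExp μ (fun x => t * f x) =
          t * ∫ x, f x * Real.exp (t * f x) ∂μ - mgf f μ t * cgf f μ t := by
        rw [entExp, ← integral_const_mul]
        simp only [mul_assoc, cgf, mgf]
      rw [e1] at h1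
      change _ ≤ _ * mgf f μ t at h1
      have h3 : t * (∫ x, f x * Real.exp (t * f x) ∂μ) / mgf f μ t - cgf f μ t ≤ t / 2 * h t := by
        rw [div_sub' (hpos t).ne', div_le_iff₀ (hpos t)]
        exact h1
      rw [mul_div_assoc] at h3
      change G t ≤ _ at h2
      linarith
  have hlim : Filter.Tendsto (fun s => cgf f μ s / s) (nhdsWithin 0 (Set.Ioi 0))
      (nhds (∫ x, f x ∂μ)) := by
    have h1 := (hdΛ 0).tendsto_slope_zero_right
    have h2 : deriv (cgf f μ) 0 = ∫ x, f x ∂μ := by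
      rw [deriv_cgf_zero (hmem 0)]
      simp
    rw [h2] at h1
    refine h1.congr fun s => ?_
    simp [div_eq_inv_mul]
  have hqT : q T ≤ ∫ x, f x ∂μ := by
    refine ge_of_tendsto hlim ?_
    filter_upwards [Ioc_mem_nhdsGT hT] with s hs
    refine (hanti hs ⟨hT, le_rfl⟩ hs.2).trans ?_
    have := hGpos s ⟨hs.1.le, hs.2⟩
    exact div_le_div_of_nonneg_right (by linarith) hs.1.le
  change mgf f μ T ≤ Real.exp (_ + G T)
  rw [← Real.log_le_iff_le_exp (hpos T)]
  rw [hq, div_le_iff₀ hT] at hqT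
  change cgf f μ T ≤ _
  linarith

end Herbst

/-! ### The smoothed norm and its increments -/

section SmoothedNorm

variable {H : Type*} [NormedAddCommGroup H]

/-- The smooth approximation `√(E² + ‖y‖²)` of the norm. -/
noncomputable def smoothNorm (E : ℝ) (y : H) : ℝ := √(E ^ 2 + ‖y‖ ^ 2)

theorem smoothNorm_nonneg (E : ℝ) (y : H) : 0 ≤ smoothNorm E y := Real.sqrt_nonneg _

theorem smoothNorm_sq (E : ℝ) (y : H) : smoothNorm E y ^ 2 = E ^ 2 + ‖y‖ ^ 2 :=
  Real.sq_sqrt (by positivity)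

theorem le_smoothNorm (E : ℝ) (y : H) : E ≤ smoothNorm E y :=
  Real.le_sqrt_of_sq_le (by nlinarith [sq_nonneg ‖y‖])

theorem smoothNorm_pos {E : ℝ} (hE : 0 < E) (y : H) : 0 < smoothNorm E y :=
  hE.trans_le (le_smoothNorm E y)

theorem norm_le_smoothNorm (E : ℝ) (y : H) : ‖y‖ ≤ smoothNorm E y :=
  Real.le_sqrt_of_sq_le (by nlinarith [sq_nonneg E])

theorem smoothNorm_le {E : ℝ} (hE : 0 ≤ E) (y : H) : smoothNorm E y ≤ ‖y‖ + E :=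
  Real.sqrt_le_iff.2 ⟨by positivity, by nlinarith [norm_nonneg y]⟩

@[fun_prop]
theorem continuous_smoothNorm (E : ℝ) : Continuous (smoothNorm E : H → ℝ) := by
  unfold smoothNorm; fun_prop

theorem smoothNorm_add_le (E : ℝ) (y v : H) :
    smoothNorm E (y + v) ≤ smoothNorm E y + ‖v‖ := by
  refine Real.sqrt_le_iff.2 ⟨add_nonneg (Real.sqrt_nonneg _) (norm_nonneg _), ?_⟩
  have h1 := smoothNorm_sq E y
  have h2 := norm_le_smoothNorm E y
  have h3 := norm_add_le y v
  nlinarith [norm_nonneg y, norm_nonneg v, norm_nonneg (y + v)]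

theorem abs_smoothNorm_add_sub_le_norm (E : ℝ) (y v : H) :
    |smoothNorm E (y + v) - smoothNorm E y| ≤ ‖v‖ := by
  refine abs_le.2 ⟨?_, ?_⟩
  · have := smoothNorm_add_le E (y + v) (-v)
    rw [add_neg_cancel_right, norm_neg] at this
    linarith
  · linarith [smoothNorm_add_le E y v]

/-- Let a, b be the two values. From b² - a² = 2⟨y, v⟩ + ‖v‖² one gets a (b - a) = ⟨y, v⟩ + (‖v‖² -
(b - a)²)/2, and the correction lies in [0, ‖v‖²/2] because |b - a| ≤ ‖v‖. Smoothing is what gives a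
≥ E in the second-order term. -/
theorem abs_smoothNorm_add_sub_le [InnerProductSpace ℝ H] {E : ℝ} (hE : 0 < E) (y v : H) :
    |smoothNorm E (y + v) - smoothNorm E y| ≤
      |inner ℝ y v| / smoothNorm E y + ‖v‖ ^ 2 / (2 * E) := by
  have p1 := smoothNorm_pos hE y
  have p2 := smoothNorm_pos hE (y + v)
  have s1 := smoothNorm_sq E y
  have s2 := smoothNorm_sq E (y + v)
  rw [norm_add_sq_real] at s2
  set a := smoothNorm E y
  set b := smoothNorm E (y + v)
  set i := inner ℝ y v with hi
  have hb : b = a + (b - a) := by ring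
  have hba : b - a = (i - (b - a) ^ 2 / 2 + ‖v‖ ^ 2 / 2) / a := by
    field_simp
    nlinarith
  have hle : |b - a| ≤ ‖v‖ := abs_smoothNorm_add_sub_le_norm E y v
  have hsq : (b - a) ^ 2 ≤ ‖v‖ ^ 2 := sq_le_sq.2 (by rwa [abs_norm])
  have hEa : E ≤ a := le_smoothNorm E y
  have h3 : ‖v‖ ^ 2 / 2 / a ≤ ‖v‖ ^ 2 / (2 * E) := by
    rw [div_div]
    gcongr
  refine le_trans ?_ (add_le_add_right h3 _)
  rw [← add_div, hba, abs_div, abs_of_pos p1]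
  gcongr
  refine abs_le.2 ⟨?_, ?_⟩
  · linarith [neg_abs_le i, sq_nonneg ‖v‖]
  · linarith [le_abs_self i, sq_nonneg (b - a)]

end SmoothedNorm

/-! ### Convexity bounds for the exponential -/

section ExpBounds

/-- By convexity, the slope (e^x - 1)/x of the chord from 0 is nondecreasing. This gives both the
gradient estimate below and the monotonicity of h(t)/t. -/
theorem exp_sub_one_mul_le {a b : ℝ} (ha : 0 ≤ a) (hab : a ≤ b) :
    (Real.exp a - 1) * b ≤ a * (Real.exp b - 1) := by
  rcases eq_or_lt_of_le (ha.trans hab) with hb | hb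
  · obtain rfl : a = 0 := le_antisymm (hb ▸ hab) ha
    simp
  have h := convexOn_exp.2 (Set.mem_univ 0) (Set.mem_univ b)
    (show 0 ≤ 1 - a / b by rw [sub_nonneg, div_le_one hb]; exact hab)
    (show 0 ≤ a / b by positivity) (by ring)
  simp only [smul_eq_mul, mul_zero, zero_add, Real.exp_zero, mul_one] at h
  rw [div_mul_cancel₀ _ hb.ne'] at h
  have h2 := mul_le_mul_of_nonneg_right h hb.le
  have h3 : (1 - a / b + a / b * Real.exp b) * b = b - a + a * Real.exp b := by
    field_simp
  linarith

theorem exp_sub_one_nonneg {a : ℝ} (ha : 0 ≤ a) : 0 ≤ Real.exp a - 1 := by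
  linarith [Real.add_one_le_exp a]

/-- The gradient estimate inserted into `φ`. -/
theorem mlsPhi_mul_le {s D a A B : ℝ} (hs : 0 ≤ s) (hDa : |D| ≤ |a|)
    (hD : |D| ≤ |a| * A + a ^ 2 * B) :
    mlsPhi (s * D) ≤ s * (2 * A ^ 2 * (|a| * (Real.exp (s * |a|) - 1)) +
      2 * B ^ 2 * (|a| ^ 3 * (Real.exp (s * |a|) - 1))) := by
  rcases eq_or_ne a 0 with rfl | ha
  · obtain rfl : D = 0 := by simpa using hDa
    simp [mlsPhi_zero]
  have ha' : 0 < |a| := abs_pos.2 ha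
  refine (mlsPhi_le _).trans ?_
  rw [abs_mul, abs_of_nonneg hs]
  -- Trading |D| for |a| in the exponential yields a second factor |D|, so that |D|² appears and (p
  -- + q)² ≤ 2p² + 2q² splits the two terms of the gradient bound.
  have h1 : (Real.exp (s * |D|) - 1) * |a| ≤ |D| * (Real.exp (s * |a|) - 1) := by
    rcases hs.eq_or_lt with rfl | hs'
    · simp
    have := exp_sub_one_mul_le (mul_nonneg hs (abs_nonneg D)) (mul_le_mul_of_nonneg_left hDa hs)
    refine le_of_mul_le_mul_left ?_ hs'
    linarith
  have h2 : |D| ^ 2 ≤ |a| ^ 2 * (2 * A ^ 2 + 2 * B ^ 2 * |a| ^ 2) := by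
    have h3 : |D| ^ 2 ≤ (|a| * A + a ^ 2 * B) ^ 2 := by gcongr
    rw [← sq_abs a] at h3
    nlinarith [sq_nonneg (|a| * A - |a| ^ 2 * B)]
  have h4 : 0 ≤ Real.exp (s * |a|) - 1 := exp_sub_one_nonneg (by positivity)
  refine le_of_mul_le_mul_right ?_ ha'
  calc s * |D| * (Real.exp (s * |D|) - 1) * |a|
      = s * |D| * ((Real.exp (s * |D|) - 1) * |a|) := by ring
    _ ≤ s * |D| * (|D| * (Real.exp (s * |a|) - 1)) := by gcongr
    _ = s * (|D| ^ 2 * (Real.exp (s * |a|) - 1)) := by ring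
    _ ≤ s * (|a| ^ 2 * (2 * A ^ 2 + 2 * B ^ 2 * |a| ^ 2) * (Real.exp (s * |a|) - 1)) := by gcongr
    _ = _ := by ring

end ExpBounds

/-! ### Lévy measures on the coordinate axes -/

section Axis

variable {d : ℕ} {ν : Measure (EuclideanSpace ℝ (Fin d))}

/-- Since f vanishes at 0, removing the jumps with u_k = 0 changes nothing. -/
theorem integrable_axisLevyMeasure_iff {k : Fin d} {f : ℝ → ℝ} (hf : Measurable f) (h0 : f 0 = 0) :
    Integrable f (axisLevyMeasure ν k) ↔ Integrable (fun u => f (u k)) ν := by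
  rw [axisLevyMeasure, integrable_map_measure hf.aestronglyMeasurable (by fun_prop)]
  change IntegrableOn (fun u => f (u k)) _ ν ↔ _
  refine integrableOn_iff_integrable_of_support_subset fun u hu => ?_
  intro h
  exact hu (by simp [h, h0])

theorem integral_axisLevyMeasure {k : Fin d} {f : ℝ → ℝ} (hf : Measurable f) (h0 : f 0 = 0) :
    ∫ u, f u ∂(axisLevyMeasure ν k) = ∫ u, f (u k) ∂ν := by
  rw [axisLevyMeasure, integral_map (by fun_prop) hf.aestronglyMeasurable]
  refine setIntegral_eq_integral_of_forall_compl_eq_zero fun u hu => ?_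
  have : u k = 0 := by simpa using hu
  simp [this, h0]

/-- `ν` is concentrated on the coordinate axes. -/
def OnAxes (ν : Measure (EuclideanSpace ℝ (Fin d))) : Prop :=
  ∀ᵐ u ∂ν, ∀ j k : Fin d, j ≠ k → u j = 0 ∨ u k = 0

theorem eq_single_of_axis {u : EuclideanSpace ℝ (Fin d)}
    (hu : ∀ j k : Fin d, j ≠ k → u j = 0 ∨ u k = 0) {k : Fin d} (hk : u k ≠ 0) :
    u = u k • EuclideanSpace.single k (1 : ℝ) := by
  ext j
  by_cases hj : j = k
  · subst hj; simp
  · simp [hj, (hu j k hj).resolve_right hk]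

end Axis

/-! ### Bounding the energy by h -/

section EnergyBound

variable {d : ℕ} {ν : Measure (EuclideanSpace ℝ (Fin d))}
  {S : Submodule ℝ (EuclideanSpace ℝ (Fin d))} {E t : ℝ}

/-- The integrals in the definition of `hFun` converge at `t`. -/
def HFunIntegrable (ν : Measure (EuclideanSpace ℝ (Fin d))) (t : ℝ) : Prop :=
  ∀ k : Fin d,
    Integrable (fun u : ℝ => |u| * (Real.exp (t * |u|) - 1)) (axisLevyMeasure ν k) ∧
    Integrable (fun u : ℝ => |u| ^ 3 * (Real.exp (t * |u|) - 1)) (axisLevyMeasure ν k)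

/-- For u on an axis at most one summand is nonzero; the sum over k allows integration against ν
without splitting it. Requiring only dominated increments covers truncations of the smoothed norm
and their negatives. -/
theorem mlsPhi_axis_le (hE : 0 < E) (ht : 0 ≤ t) {f : EuclideanSpace ℝ (Fin d) → ℝ}
    (hf : ∀ x u, |f (x + u) - f x| ≤
      |smoothNorm E (S.starProjection (x + u)) - smoothNorm E (S.starProjection x)|)
    (x : EuclideanSpace ℝ (Fin d)) {u : EuclideanSpace ℝ (Fin d)}
    (hu : ∀ j k : Fin d, j ≠ k → u j = 0 ∨ u k = 0) :
    mlsPhi (t * f (x + u) - t * f x) ≤ ∑ k, t *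
      (2 * (S.starProjection x k / smoothNorm E (S.starProjection x)) ^ 2 *
        (|u k| * (Real.exp (t * |u k|) - 1)) +
      2 * (‖S.starProjection (EuclideanSpace.single k (1 : ℝ))‖ ^ 2 / (2 * E)) ^ 2 *
        (|u k| ^ 3 * (Real.exp (t * |u k|) - 1))) := by
  by_cases h0 : ∃ k, u k ≠ 0
  swap
  · push Not at h0
    have : u = 0 := by ext k; simpa using h0 k
    subst this
    simp [mlsPhi_zero]
  obtain ⟨k, hk⟩ := h0
  have hsing := eq_single_of_axis hu hk
  have hzero : ∀ j, j ≠ k → u j = 0 := fun j hj => (hu j k hj).resolve_right hk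
  rw [Finset.sum_eq_single k (fun j _ hj => by simp [hzero j hj]) (by simp), ← mul_sub]
  have hpos := smoothNorm_pos hE (S.starProjection x)
  set g := smoothNorm E (S.starProjection x) with hg
  set e : EuclideanSpace ℝ (Fin d) := EuclideanSpace.single k (1 : ℝ) with he
  have hproj : S.starProjection (x + u) = S.starProjection x + u k • S.starProjection e := by
    conv_lhs => rw [hsing]
    rw [map_add, map_smul]
  have hle1 : ‖S.starProjection e‖ ≤ 1 := by
    refine (S.norm_starProjection_apply_le e).trans ?_
    simp [he]
  have hin : inner ℝ (S.starProjection x) (u k • S.starProjection e) =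
      u k * S.starProjection x k := by
    rw [inner_smul_right, ← Submodule.inner_starProjection_left_eq_right,
      Submodule.starProjection_eq_self_iff.2 (Submodule.starProjection_apply_mem S x), he,
      EuclideanSpace.inner_single_right]
    simp
  have hDa : |f (x + u) - f x| ≤ |u k| := by
    refine (hf x u).trans ?_
    rw [hproj]
    refine (abs_smoothNorm_add_sub_le_norm E _ _).trans ?_
    rw [norm_smul, Real.norm_eq_abs]
    exact mul_le_of_le_one_right (abs_nonneg _) hle1
  have hD : |f (x + u) - f x| ≤ |u k| * (|S.starProjection x k| / g) +
      u k ^ 2 * (‖S.starProjection e‖ ^ 2 / (2 * E)) := by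
    refine (hf x u).trans ?_
    rw [hproj]
    refine (abs_smoothNorm_add_sub_le hE _ _).trans (le_of_eq ?_)
    rw [hin, norm_smul, abs_mul, Real.norm_eq_abs, mul_pow, sq_abs]
    ring
  have := mlsPhi_mul_le ht hDa hD
  rwa [div_pow, sq_abs, ← div_pow] at this

/-- These weights average the first-order axis integrals, which is why h contains their maximum and
not their sum. -/
theorem sum_sq_proj_div_le (hE : 0 < E) (y : EuclideanSpace ℝ (Fin d)) :
    ∑ k, (y k / smoothNorm E y) ^ 2 ≤ 1 := by
  simp only [div_pow]
  rw [← Finset.sum_div, div_le_one (pow_pos (smoothNorm_pos hE y) 2), smoothNorm_sq,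
    EuclideanSpace.real_norm_sq_eq]
  linarith [sq_nonneg E]

theorem integral_axis_nonneg (k : Fin d) (ht : 0 ≤ t) :
    0 ≤ ∫ u, |u| * (Real.exp (t * |u|) - 1) ∂(axisLevyMeasure ν k) :=
  integral_nonneg fun u => mul_nonneg (abs_nonneg u) (exp_sub_one_nonneg (by positivity))

theorem integral_axis_cube_nonneg (k : Fin d) (ht : 0 ≤ t) :
    0 ≤ ∫ u, |u| ^ 3 * (Real.exp (t * |u|) - 1) ∂(axisLevyMeasure ν k) :=
  integral_nonneg fun u => mul_nonneg (by positivity) (exp_sub_one_nonneg (by positivity))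

theorem hFun_nonneg (ht : 0 ≤ t) : 0 ≤ hFun ν S E t :=
  add_nonneg (mul_nonneg (by norm_num) (Real.iSup_nonneg fun k => integral_axis_nonneg k ht))
    (mul_nonneg (by positivity) (Finset.sum_nonneg fun k _ =>
      mul_nonneg (by positivity) (integral_axis_cube_nonneg k ht)))

theorem lintegral_mlsPhi_le (hax : OnAxes ν) (hE : 0 < E) (ht : 0 ≤ t) (hI : HFunIntegrable ν t)
    {η : Measure (EuclideanSpace ℝ (Fin d))} (hη : η ≤ (2 : ENNReal) • ν)
    {f : EuclideanSpace ℝ (Fin d) → ℝ}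
    (hf : ∀ x u, |f (x + u) - f x| ≤
      |smoothNorm E (S.starProjection (x + u)) - smoothNorm E (S.starProjection x)|)
    (x : EuclideanSpace ℝ (Fin d)) :
    ∫⁻ u, ENNReal.ofReal (mlsPhi (t * f (x + u) - t * f x)) ∂η ≤
      ENNReal.ofReal (t / 2 * hFun ν S E t) := by
  set w : Fin d → ℝ := fun k => S.starProjection x k / smoothNorm E (S.starProjection x) with hw
  set p : Fin d → ℝ := fun k => ‖S.starProjection (EuclideanSpace.single k (1 : ℝ))‖ with hp
  set B : Fin d → ℝ := fun k => ∫ u, |u| * (Real.exp (t * |u|) - 1) ∂(axisLevyMeasure ν k) with hB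
  set D : Fin d → ℝ :=
    fun k => ∫ u, |u| ^ 3 * (Real.exp (t * |u|) - 1) ∂(axisLevyMeasure ν k) with hD
  have m1 : Measurable fun u : ℝ => |u| * (Real.exp (t * |u|) - 1) := by fun_prop
  have m3 : Measurable fun u : ℝ => |u| ^ 3 * (Real.exp (t * |u|) - 1) := by fun_prop
  have i1 := fun k => (integrable_axisLevyMeasure_iff m1 (by simp)).1 (hI k).1
  have i3 := fun k => (integrable_axisLevyMeasure_iff m3 (by simp)).1 (hI k).2
  have e1 := fun k => integral_axisLevyMeasure (ν := ν) (k := k) m1 (by simp)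
  have e3 := fun k => integral_axisLevyMeasure (ν := ν) (k := k) m3 (by simp)
  have itot : ∀ k, Integrable (fun u : EuclideanSpace ℝ (Fin d) => t *
      (2 * w k ^ 2 * (|u k| * (Real.exp (t * |u k|) - 1)) +
      2 * (p k ^ 2 / (2 * E)) ^ 2 * (|u k| ^ 3 * (Real.exp (t * |u k|) - 1)))) ν := fun k =>
    (((i1 k).const_mul _).add ((i3 k).const_mul _)).const_mul _
  have hBle : ∀ k, B k ≤ ⨆ k, B k := fun k => le_ciSup (Set.finite_range B).bddAbove k
  have hB0 : 0 ≤ ⨆ k, B k := Real.iSup_nonneg fun k => integral_axis_nonneg k ht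
  calc ∫⁻ u, ENNReal.ofReal (mlsPhi (t * f (x + u) - t * f x)) ∂η
      ≤ ∫⁻ u, ENNReal.ofReal (mlsPhi (t * f (x + u) - t * f x)) ∂((2 : ENNReal) • ν) :=
        lintegral_mono' hη le_rfl
    _ = 2 * ∫⁻ u, ENNReal.ofReal (mlsPhi (t * f (x + u) - t * f x)) ∂ν := by
        rw [lintegral_smul_measure, smul_eq_mul]
    _ ≤ 2 * ∫⁻ u, ENNReal.ofReal (∑ k, t *
      (2 * w k ^ 2 * (|u k| * (Real.exp (t * |u k|) - 1)) +
      2 * (p k ^ 2 / (2 * E)) ^ 2 * (|u k| ^ 3 * (Real.exp (t * |u k|) - 1)))) ∂ν := by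
        gcongr 2 * ?_
        refine lintegral_mono_ae ?_
        filter_upwards [hax] with u hu
        exact ENNReal.ofReal_le_ofReal (mlsPhi_axis_le hE ht hf x hu)
    _ = 2 * ENNReal.ofReal (∑ k, t * (2 * w k ^ 2 * B k + 2 * (p k ^ 2 / (2 * E)) ^ 2 * D k)) := by
        rw [← ofReal_integral_eq_lintegral_ofReal (integrable_finsetSum _ fun k _ => itot k)]
        · rw [integral_finsetSum _ fun k _ => itot k]
          congr 2
          refine Finset.sum_congr rfl fun k _ => ?_
          rw [integral_const_mul, integral_add ((i1 k).const_mul _) ((i3 k).const_mul _),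
            integral_const_mul, integral_const_mul, ← e1, ← e3]
        · refine Filter.Eventually.of_forall fun u => Finset.sum_nonneg fun k _ => ?_
          have : 0 ≤ Real.exp (t * |u k|) - 1 := exp_sub_one_nonneg (by positivity)
          positivity
    _ = ENNReal.ofReal (2 * ∑ k, t *
          (2 * w k ^ 2 * B k + 2 * (p k ^ 2 / (2 * E)) ^ 2 * D k)) := by
        rw [ENNReal.ofReal_mul (by norm_num)]
        simp
    _ ≤ ENNReal.ofReal (t / 2 * hFun ν S E t) := by
        refine ENNReal.ofReal_le_ofReal ?_
        have h1 : ∑ k, w k ^ 2 * B k ≤ ⨆ k, B k := by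
          calc ∑ k, w k ^ 2 * B k ≤ ∑ k, w k ^ 2 * ⨆ k, B k := by
                gcongr with k
                exact hBle k
            _ = (∑ k, w k ^ 2) * ⨆ k, B k := by rw [Finset.sum_mul]
            _ ≤ 1 * ⨆ k, B k := by
                gcongr
                exact sum_sq_proj_div_le hE _
            _ = _ := one_mul _
        -- The 8 is 2 (from η ≤ 2ν) times 2 (from splitting the square) times 2 (from the prefactor
        -- t/2). The same factors times 1/(2E)² give 2/E².
        have e2 : 2 * ∑ k, t * (2 * w k ^ 2 * B k + 2 * (p k ^ 2 / (2 * E)) ^ 2 * D k) =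
            t / 2 * (8 * ∑ k, w k ^ 2 * B k + 2 / E ^ 2 * ∑ k, p k ^ 4 * D k) := by
          simp only [Finset.mul_sum, ← Finset.sum_add_distrib]
          refine Finset.sum_congr rfl fun k _ => ?_
          field_simp
          ring
        rw [e2]
        unfold hFun
        gcongr

theorem entExp_mul_le (hax : OnAxes ν) (hE : 0 < E) (ht : 0 ≤ t) (hI : HFunIntegrable ν t)
    {μ η : Measure (EuclideanSpace ℝ (Fin d))} [IsProbabilityMeasure μ] (hμ : HasMLSI μ η)
    (hη : η ≤ (2 : ENNReal) • ν) {f : EuclideanSpace ℝ (Fin d) → ℝ} (hfm : Measurable f)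
    {C : ℝ} (hC : ∀ x, |f x| ≤ C)
    (hf : ∀ x u, |f (x + u) - f x| ≤
      |smoothNorm E (S.starProjection (x + u)) - smoothNorm E (S.starProjection x)|) :
    entExp μ (fun x => t * f x) ≤ t / 2 * hFun ν S E t * ∫ x, Real.exp (t * f x) ∂μ := by
  have h0 : 0 ≤ t / 2 * hFun ν S E t := mul_nonneg (by positivity) (hFun_nonneg ht)
  have hint := integrable_exp_mul_of_bounded (μ := μ) hfm hC t
  have h1 : ENNReal.ofReal (entExp μ (fun x => t * f x)) ≤
      ENNReal.ofReal (t / 2 * hFun ν S E t * ∫ x, Real.exp (t * f x) ∂μ) := by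
    calc ENNReal.ofReal (entExp μ (fun x => t * f x))
        ≤ mlsEnergy μ η (fun x => t * f x) :=
          hμ _ (by fun_prop) ⟨|t| * C, fun x => by rw [abs_mul]; gcongr; exact hC x⟩
      _ ≤ ∫⁻ x, ENNReal.ofReal (Real.exp (t * f x)) *
            ENNReal.ofReal (t / 2 * hFun ν S E t) ∂μ :=
          lintegral_mono fun x => by
            gcongr
            exact lintegral_mlsPhi_le hax hE ht hI hη hf x
      _ = _ := by
          rw [lintegral_mul_const _ (by fun_prop), ← ofReal_integral_eq_lintegral_ofReal hint
            (Filter.Eventually.of_forall fun x => (Real.exp_pos _).le), mul_comm,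
            ← ENNReal.ofReal_mul h0]
  exact (ENNReal.ofReal_le_ofReal_iff
    (mul_nonneg h0 (integral_nonneg fun x => (Real.exp_pos _).le))).1 h1

end EnergyBound

/-! ### The Lévy–Khintchine kernel and its second differences -/

section LevyKernel

variable {d : ℕ} {ν : Measure (EuclideanSpace ℝ (Fin d))}

open Classical in
/-- The integrand of the Lévy–Khintchine exponent. -/
noncomputable def levyKernel (t u : EuclideanSpace ℝ (Fin d)) : ℂ :=
  Complex.exp (Complex.I * ((inner ℝ t u : ℝ) : ℂ)) - 1 -
    (if ‖u‖ ≤ 1 then Complex.I * ((inner ℝ t u : ℝ) : ℂ) else 0)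

theorem levyExponent_eq (γ t : EuclideanSpace ℝ (Fin d)) :
    levyExponent γ ν t = Complex.I * ((inner ℝ t γ : ℝ) : ℂ) + ∫ u, levyKernel t u ∂ν := rfl

theorem IsLevyMeasure.integrable_min (h : IsLevyMeasure ν) :
    Integrable (fun u => min 1 (‖u‖ ^ 2)) ν := by
  refine ⟨by fun_prop, ?_⟩
  rw [hasFiniteIntegral_iff_ofReal (Filter.Eventually.of_forall fun u => by positivity)]
  exact h.lintegral_lt_top

theorem norm_exp_I_mul_sub_one_le_two (x : ℝ) : ‖Complex.exp (Complex.I * x) - 1‖ ≤ 2 := by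
  refine (norm_sub_le _ _).trans ?_
  rw [mul_comm, Complex.norm_exp_ofReal_mul_I]
  norm_num

theorem norm_exp_I_mul_sub_one_sub_le (x : ℝ) :
    ‖Complex.exp (Complex.I * x) - 1 - Complex.I * x‖ ≤ 3 * x ^ 2 := by
  have hn : ‖Complex.I * (x : ℂ)‖ = |x| := by simp
  rcases le_total |x| 1 with h | h
  · refine (Complex.norm_exp_sub_one_sub_id_le (hn ▸ h)).trans ?_
    rw [hn, sq_abs]
    nlinarith [sq_nonneg x]
  · refine (norm_sub_le _ _).trans ?_
    rw [hn]
    have h1 := norm_exp_I_mul_sub_one_le_two x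
    rw [← sq_abs x]
    nlinarith

theorem measurable_levyKernel (t : EuclideanSpace ℝ (Fin d)) : Measurable (levyKernel t) := by
  classical
  unfold levyKernel
  refine Measurable.sub (by fun_prop) (Measurable.ite ?_ (by fun_prop) (by fun_prop))
  exact measurableSet_le (by fun_prop) (by fun_prop)

theorem norm_levyKernel_le (t u : EuclideanSpace ℝ (Fin d)) :
    ‖levyKernel t u‖ ≤ (3 * ‖t‖ ^ 2 + 2) * min 1 (‖u‖ ^ 2) := by
  unfold levyKernel
  split_ifs with h
  · have h2 : ‖u‖ ^ 2 ≤ 1 := pow_le_one₀ (norm_nonneg u) h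
    rw [min_eq_right h2]
    refine (norm_exp_I_mul_sub_one_sub_le _).trans ?_
    have h3 : (inner ℝ t u) ^ 2 ≤ (‖t‖ * ‖u‖) ^ 2 :=
      sq_le_sq.2 (by rw [abs_of_nonneg (by positivity : 0 ≤ ‖t‖ * ‖u‖)]
                     exact abs_real_inner_le_norm t u)
    nlinarith [sq_nonneg ‖u‖]
  · have h2 : 1 ≤ ‖u‖ ^ 2 := one_le_pow₀ (not_le.1 h).le
    rw [min_eq_left h2, sub_zero]
    refine (norm_exp_I_mul_sub_one_le_two _).trans ?_
    nlinarith [sq_nonneg ‖t‖]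

theorem IsLevyMeasure.integrable_levyKernel (h : IsLevyMeasure ν)
    (t : EuclideanSpace ℝ (Fin d)) : Integrable (levyKernel t) ν :=
  (h.integrable_min.const_mul (3 * ‖t‖ ^ 2 + 2)).mono'
    (measurable_levyKernel t).aestronglyMeasurable
    (Filter.Eventually.of_forall fun u => norm_levyKernel_le t u)

/-- The compensator is linear in the frequency, so it drops out of the second difference. -/
theorem levyKernel_add_sub (s t u : EuclideanSpace ℝ (Fin d)) :
    levyKernel (s + t) u - levyKernel s u - levyKernel t u =
      (Complex.exp (Complex.I * ((inner ℝ s u : ℝ) : ℂ)) - 1) *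
      (Complex.exp (Complex.I * ((inner ℝ t u : ℝ) : ℂ)) - 1) := by
  unfold levyKernel
  rw [inner_add_left]
  push_cast
  rw [mul_add, Complex.exp_add]
  split_ifs <;> ring

theorem IsLevyMeasure.levyExponent_add_sub (h : IsLevyMeasure ν)
    (γ s t : EuclideanSpace ℝ (Fin d)) :
    levyExponent γ ν (s + t) - levyExponent γ ν s - levyExponent γ ν t =
      ∫ u, (Complex.exp (Complex.I * ((inner ℝ s u : ℝ) : ℂ)) - 1) *
        (Complex.exp (Complex.I * ((inner ℝ t u : ℝ) : ℂ)) - 1) ∂ν := by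
  simp only [← levyKernel_add_sub]
  have i1 := h.integrable_levyKernel (s + t)
  have i2 := h.integrable_levyKernel s
  have i3 := h.integrable_levyKernel t
  rw [integral_sub (by fun_prop) i3, integral_sub i1 i2, levyExponent_eq, levyExponent_eq, levyExponent_eq,
    inner_add_left]
  push_cast
  ring

theorem IsLevyMeasure.integrable_mul_kernel (h : IsLevyMeasure ν)
    (s t : EuclideanSpace ℝ (Fin d)) :
    Integrable (fun u => (Complex.exp (Complex.I * ((inner ℝ s u : ℝ) : ℂ)) - 1) *
        (Complex.exp (Complex.I * ((inner ℝ t u : ℝ) : ℂ)) - 1)) ν := by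
  simp only [← levyKernel_add_sub]
  exact ((h.integrable_levyKernel _).sub (h.integrable_levyKernel _)).sub
    (h.integrable_levyKernel _)

/-- Symmetrizing each factor turns it into -2(1 - cos), so the sum is real and nonnegative. -/
theorem sum_signs_mul_kernel (x y : ℝ) :
    (Complex.exp (Complex.I * (x : ℂ)) - 1) * (Complex.exp (Complex.I * (y : ℂ)) - 1) +
    (Complex.exp (Complex.I * ((-x : ℝ) : ℂ)) - 1) * (Complex.exp (Complex.I * (y : ℂ)) - 1) +
    (Complex.exp (Complex.I * (x : ℂ)) - 1) * (Complex.exp (Complex.I * ((-y : ℝ) : ℂ)) - 1) +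
    (Complex.exp (Complex.I * ((-x : ℝ) : ℂ)) - 1) *
      (Complex.exp (Complex.I * ((-y : ℝ) : ℂ)) - 1) =
    ((4 * ((1 - Real.cos x) * (1 - Real.cos y)) : ℝ) : ℂ) := by
  have key : ∀ z : ℝ, (Complex.exp (Complex.I * (z : ℂ)) - 1) +
      (Complex.exp (Complex.I * ((-z : ℝ) : ℂ)) - 1) = -(2 * (1 - Complex.cos z)) := fun z => by
    rw [Complex.cos, mul_comm Complex.I, mul_comm Complex.I]
    push_cast
    ring
  push_cast
  have kx := key x
  have ky := key y
  push_cast at kx ky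
  linear_combination (Complex.exp (Complex.I * (y : ℂ)) - 1 +
    (Complex.exp (Complex.I * (-(y : ℂ))) - 1)) * kx - 2 * (1 - Complex.cos x) * ky

end LevyKernel

/-! ### Independent components force the Lévy measure onto the axes -/

section Independence

variable {Ω : Type*} [MeasurableSpace Ω] {P : Measure Ω} [IsProbabilityMeasure P] {d : ℕ}
  {X : Ω → EuclideanSpace ℝ (Fin d)} {γ : EuclideanSpace ℝ (Fin d)}
  {ν : Measure (EuclideanSpace ℝ (Fin d))}

/-- The characteristic function is a product over coordinates, and in each coordinate one of the two
frequencies is 0 and contributes the factor 1. -/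
theorem charFun_add_of_iIndepFun (hXm : AEMeasurable X P)
    (hindep : iIndepFun (fun (k : Fin d) (ω : Ω) => X ω k) P)
    {s t : EuclideanSpace ℝ (Fin d)} (hst : ∀ i, s i = 0 ∨ t i = 0) :
    charFun (P.map X) (s + t) = charFun (P.map X) s * charFun (P.map X) t := by
  have hXk : ∀ k : Fin d, AEMeasurable (fun ω => X ω k) P := fun k =>
    (by fun_prop : Measurable fun u : EuclideanSpace ℝ (Fin d) => u k).comp_aemeasurable hXm
  have hprod := (iIndepFun_iff_charFun_pi hXk).1 hindep
  change ∀ t, charFun (P.map X) t = _ at hprod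
  rw [hprod, hprod, hprod, ← Finset.prod_mul_distrib]
  refine Finset.prod_congr rfl fun i _ => ?_
  have : IsProbabilityMeasure (P.map fun ω => X ω i) := Measure.isProbabilityMeasure_map (hXk i)
  rcases hst i with h | h <;> simp [h]

/-- Factorization of the characteristic function determines the second difference of the exponent
only modulo 2πi. Multiplying the four sign choices leaves the exponential of a real integral equal
to 1, and the ambiguity disappears. -/
theorem integral_cos_mul_cos_eq_zero (hX : IsIDVector P X γ ν)
    (hindep : iIndepFun (fun (k : Fin d) (ω : Ω) => X ω k) P)
    {s t : EuclideanSpace ℝ (Fin d)} (hst : ∀ i, s i = 0 ∨ t i = 0) :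
    ∫ u, (1 - Real.cos (inner ℝ s u)) * (1 - Real.cos (inner ℝ t u)) ∂ν = 0 := by
  have hexp : ∀ s t : EuclideanSpace ℝ (Fin d), (∀ i, s i = 0 ∨ t i = 0) →
      Complex.exp (∫ u, (Complex.exp (Complex.I * ((inner ℝ s u : ℝ) : ℂ)) - 1) *
        (Complex.exp (Complex.I * ((inner ℝ t u : ℝ) : ℂ)) - 1) ∂ν) = 1 := fun s t hst => by
    have := charFun_add_of_iIndepFun hX.aemeasurable hindep hst
    rw [hX.charFun_eq, hX.charFun_eq, hX.charFun_eq] at this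
    rw [← hX.levy.levyExponent_add_sub γ, Complex.exp_sub, Complex.exp_sub, this]
    field_simp [Complex.exp_ne_zero]
  have h1 := hexp s t hst
  have h2 := hexp (-s) t fun i => by simpa using hst i
  have h3 := hexp s (-t) fun i => by simpa using hst i
  have h4 := hexp (-s) (-t) fun i => by simpa using hst i
  have i1 := hX.levy.integrable_mul_kernel s t
  have i2 := hX.levy.integrable_mul_kernel (-s) t
  have i3 := hX.levy.integrable_mul_kernel s (-t)
  have i4 := hX.levy.integrable_mul_kernel (-s) (-t)
  have hsum := congrArg₂ (· * ·) (congrArg₂ (· * ·) (congrArg₂ (· * ·) h1 h2) h3) h4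
  simp only [← Complex.exp_add, mul_one] at hsum
  rw [← integral_add i1 i2, ← integral_add (by fun_prop) i3,
    ← integral_add (by fun_prop) i4] at hsum
  simp only [inner_neg_left, sum_signs_mul_kernel] at hsum
  rw [integral_complex_ofReal, ← Complex.ofReal_exp, Complex.ofReal_eq_one, Real.exp_eq_one_iff,
    integral_const_mul] at hsum
  linarith

theorem integrable_cos_mul_cos (h : IsLevyMeasure ν) (s t : EuclideanSpace ℝ (Fin d)) :
    Integrable (fun u => (1 - Real.cos (inner ℝ s u)) * (1 - Real.cos (inner ℝ t u))) ν := by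
  have hi := h.integrable_mul_kernel
  have h1 := (((hi s t).add (hi (-s) t)).add (hi s (-t))).add (hi (-s) (-t))
  have h1' : Integrable (fun u => ((4 * ((1 - Real.cos (inner ℝ s u)) *
      (1 - Real.cos (inner ℝ t u))) : ℝ) : ℂ)) ν := h1.congr (Filter.Eventually.of_forall fun u => by
    simp only [Pi.add_apply, inner_neg_left, sum_signs_mul_kernel])
  have h2 := h1'.re.const_mul (1 / 4)
  refine h2.congr (Filter.Eventually.of_forall fun u => ?_)
  simp only [RCLike.re_to_complex, Complex.ofReal_re]
  ring

/-- A single frequency misses the points of 2πℤ. The frequencies 1/n detect every x ≠ 0, and being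
countably many they share one null set. -/
theorem exists_one_sub_cos_ne_zero {x : ℝ} (hx : x ≠ 0) : ∃ n : ℕ, 1 - Real.cos (x / n) ≠ 0 := by
  obtain ⟨n, hn⟩ := exists_nat_gt |x|
  have hn0 : (0 : ℝ) < n := (abs_nonneg x).trans_lt hn
  refine ⟨n, fun h => ?_⟩
  have hlt : |x / n| < 1 := by rwa [abs_div, abs_of_pos hn0, div_lt_one hn0]
  have h2 := abs_lt.1 hlt
  have := (Real.cos_eq_one_iff_of_lt_of_lt (x := x / n) (by linarith [Real.pi_gt_three])
    (by linarith [Real.pi_gt_three])).1 (by linarith)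
  exact hx (by simpa [hn0.ne'] using this)

/-- The Lévy measure of a vector with independent components is concentrated on the axes. -/
theorem IsIDVector.onAxes (hX : IsIDVector P X γ ν)
    (hindep : iIndepFun (fun (k : Fin d) (ω : Ω) => X ω k) P) : OnAxes ν := by
  unfold OnAxes
  simp only [ae_all_iff]
  intro j k hjk
  have key : ∀ n m : ℕ, ∀ᵐ u ∂ν,
      (1 - Real.cos (u j / n)) * (1 - Real.cos (u k / m)) = 0 := fun n m => by
    have hst : ∀ i, EuclideanSpace.single j (1 / n : ℝ) i = 0 ∨
        EuclideanSpace.single k (1 / m : ℝ) i = 0 := fun i => by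
      by_cases hi : i = j
      · right; simp [hi, hjk]
      · left; simp [hi]
    have h0 := integral_cos_mul_cos_eq_zero hX hindep hst
    rw [integral_eq_zero_iff_of_nonneg (fun u => mul_nonneg
      (by linarith [Real.cos_le_one (inner ℝ (EuclideanSpace.single j (1 / n : ℝ)) u)])
      (by linarith [Real.cos_le_one (inner ℝ (EuclideanSpace.single k (1 / m : ℝ)) u)]))
      (integrable_cos_mul_cos hX.levy _ _)] at h0
    filter_upwards [h0] with u hu
    simpa [EuclideanSpace.inner_single_left, div_eq_inv_mul] using hu
  simp only [← ae_all_iff] at key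
  filter_upwards [key] with u hu
  by_contra! hne
  obtain ⟨n, hn⟩ := exists_one_sub_cos_ne_zero hne.1
  obtain ⟨m, hm⟩ := exists_one_sub_cos_ne_zero hne.2
  exact mul_ne_zero hn hm (hu n m)

end Independence

/-! ### Binomial approximation of compound Poisson laws -/

section BinomialApproximation

variable {d : ℕ}

/-- The law of a jump which is drawn from `η` at rate `1 / N` and is `0` otherwise. -/
noncomputable def binStep (η : Measure (EuclideanSpace ℝ (Fin d))) (N : ℕ) :
    Measure (EuclideanSpace ℝ (Fin d)) :=
  ENNReal.ofReal (1 - η.real Set.univ / N) • Measure.dirac 0 + (N : ENNReal)⁻¹ • η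

/-- Binomial approximation of the compound Poisson law with jump measure `η`. -/
noncomputable def binLaw (η : Measure (EuclideanSpace ℝ (Fin d))) (N : ℕ) :
    Measure (EuclideanSpace ℝ (Fin d)) := convPow (binStep η N) N

/-- The exponent of the compound Poisson law with jump measure `η`. -/
noncomputable def jumpExponent (η : Measure (EuclideanSpace ℝ (Fin d)))
    (t : EuclideanSpace ℝ (Fin d)) : ℂ :=
  ∫ u, (Complex.exp (Complex.I * ((inner ℝ t u : ℝ) : ℂ)) - 1) ∂η

variable {η : Measure (EuclideanSpace ℝ (Fin d))} [IsFiniteMeasure η] {N : ℕ}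

theorem isProbabilityMeasure_binStep (hN : 0 < N) (h : η.real Set.univ ≤ N) :
    IsProbabilityMeasure (binStep η N) := by
  have hN' : (0 : ℝ) < N := by exact_mod_cast hN
  constructor
  have e : (N : ENNReal)⁻¹ * η Set.univ = ENNReal.ofReal (η.real Set.univ / N) := by
    rw [div_eq_inv_mul, ENNReal.ofReal_mul (by positivity), ENNReal.ofReal_inv_of_pos hN',
      ENNReal.ofReal_natCast, ofReal_measureReal]
  simp only [binStep, Measure.add_apply, Measure.smul_apply, measure_univ, smul_eq_mul, mul_one]
  rw [e, ← ENNReal.ofReal_add]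
  · simp
  · rw [sub_nonneg, div_le_one hN']
    exact h
  · positivity

/-- The condition on N leaves each step an atom a ≥ 1/2. The N steps, with jump measure a⁻¹ N⁻¹ η
each, add up to a⁻¹ η ≤ 2η. -/
theorem hasMLSI_binLaw (hN : 0 < N) (h : 2 * η.real Set.univ ≤ N) :
    ∃ η', SFinite η' ∧ HasMLSI (binLaw η N) η' ∧ η' ≤ (2 : ENNReal) • η := by
  have hN' : (0 : ℝ) < N := by exact_mod_cast hN
  have h0 : 0 ≤ η.real Set.univ := measureReal_nonneg
  have hp := isProbabilityMeasure_binStep (η := η) hN (by linarith)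
  have hhalf : (1 / 2 : ℝ) ≤ 1 - η.real Set.univ / N := by
    have : η.real Set.univ / N ≤ 1 / 2 := by
      rw [div_le_iff₀ hN']
      linarith
    linarith
  have ha : ENNReal.ofReal (1 - η.real Set.univ / N) ≠ 0 := by
    rw [Ne, ENNReal.ofReal_eq_zero, not_le]
    linarith
  unfold binLaw
  unfold binStep at hp ⊢
  refine ⟨_, ?_, (hasMLSI_atom_add _ ha ((N : ENNReal)⁻¹ • η)).conv_pow N, ?_⟩
  · infer_instance
  · rw [smul_smul, smul_smul, mul_right_comm, ENNReal.mul_inv_cancel (by simpa using hN.ne')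
      (by simp), one_mul]
    refine Measure.le_intro fun s _ _ => ?_
    simp only [Measure.smul_apply, smul_eq_mul]
    gcongr
    rw [ENNReal.inv_le_iff_inv_le]
    refine le_trans (le_of_eq ?_) (ENNReal.ofReal_le_ofReal hhalf)
    rw [one_div, ENNReal.ofReal_inv_of_pos (by norm_num)]
    simp

theorem integrable_jump (t : EuclideanSpace ℝ (Fin d)) :
    Integrable (fun u => Complex.exp (Complex.I * ((inner ℝ t u : ℝ) : ℂ)) - 1) η :=
  Integrable.of_bound (by fun_prop) 2
    (Filter.Eventually.of_forall fun u => norm_exp_I_mul_sub_one_le_two _)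

theorem norm_jumpExponent_le (t : EuclideanSpace ℝ (Fin d)) :
    ‖jumpExponent η t‖ ≤ 2 * η.real Set.univ :=
  norm_integral_le_of_norm_le_const
    (Filter.Eventually.of_forall fun _ => norm_exp_I_mul_sub_one_le_two _)

theorem jumpExponent_re_nonpos (t : EuclideanSpace ℝ (Fin d)) : (jumpExponent η t).re ≤ 0 := by
  unfold jumpExponent
  have := integral_re (integrable_jump (η := η) t)
  simp only [RCLike.re_to_complex] at this
  rw [← this]
  refine integral_nonpos fun u => ?_
  rw [mul_comm, Complex.sub_re, Complex.exp_ofReal_mul_I_re]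
  simpa using Real.cos_le_one _

theorem charFun_binStep (hN : 0 < N) (h : η.real Set.univ ≤ N) (t : EuclideanSpace ℝ (Fin d)) :
    charFun (binStep η N) t = 1 + jumpExponent η t / N := by
  have hN' : (0 : ℝ) < N := by exact_mod_cast hN
  have hNC : (N : ℂ) ≠ 0 := by exact_mod_cast hN.ne'
  have h1 : 0 ≤ 1 - η.real Set.univ / N := by
    rw [sub_nonneg, div_le_one hN']
    exact h
  have hi : Integrable (fun u => Complex.exp (Complex.I * ((inner ℝ t u : ℝ) : ℂ))) η := by
    exact ((integrable_jump (η := η) t).add (integrable_const 1)).congr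
      (Filter.Eventually.of_forall fun u => by simp)
  have hc : ∀ u, Complex.exp (((inner ℝ u t : ℝ) : ℂ) * Complex.I) =
      Complex.exp (Complex.I * ((inner ℝ t u : ℝ) : ℂ)) := fun u => by
    rw [mul_comm, real_inner_comm]
  have hi2 : Integrable (fun u => Complex.exp (Complex.I * ((inner ℝ t u : ℝ) : ℂ)))
      ((N : ENNReal)⁻¹ • η) := hi.smul_measure (by simpa using hN.ne')
  have hi1 : Integrable (fun u => Complex.exp (Complex.I * ((inner ℝ t u : ℝ) : ℂ)))
      (ENNReal.ofReal (1 - η.real Set.univ / N) • Measure.dirac 0) :=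
    (integrable_dirac' (by fun_prop : Measurable _).stronglyMeasurable (by simp)).smul_measure
      (by simp)
  rw [charFun_apply, binStep, jumpExponent]
  simp only [hc]
  rw [integral_add_measure hi1 hi2, integral_smul_measure, integral_smul_measure,
    integral_dirac' _ _ (by fun_prop : Measurable _).stronglyMeasurable,
    ENNReal.toReal_ofReal h1, integral_sub hi (integrable_const _)]
  simp only [inner_zero_right, Complex.ofReal_zero, mul_zero, Complex.exp_zero, integral_const,
    ENNReal.toReal_inv, ENNReal.toReal_natCast, Complex.real_smul]
  push_cast
  field_simp
  ring

theorem charFun_convPow (μ : Measure (EuclideanSpace ℝ (Fin d))) [IsProbabilityMeasure μ] (n : ℕ)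
    (t : EuclideanSpace ℝ (Fin d)) : charFun (convPow μ n) t = charFun μ t ^ n := by
  induction n with
  | zero => simp [convPow]
  | succ n ih => rw [convPow, charFun_conv, ih, pow_succ]

theorem norm_pow_sub_pow_le {x y : ℂ} (hx : ‖x‖ ≤ 1) (hy : ‖y‖ ≤ 1) (n : ℕ) :
    ‖x ^ n - y ^ n‖ ≤ n * ‖x - y‖ := by
  induction n with
  | zero => simp
  | succ n ih =>
    have e : x ^ (n + 1) - y ^ (n + 1) = (x ^ n - y ^ n) * x + y ^ n * (x - y) := by ring
    rw [e]
    refine (norm_add_le _ _).trans ?_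
    rw [norm_mul, norm_mul, norm_pow]
    have h1 : ‖y‖ ^ n ≤ 1 := pow_le_one₀ (norm_nonneg y) hy
    have h2 := mul_le_mul ih hx (norm_nonneg x) (by positivity)
    have h3 := mul_le_mul_of_nonneg_right h1 (norm_nonneg (x - y))
    push_cast
    linarith

/-- With z = `jumpExponent η t` / N, compare (1 + z)^N and (e^z)^N. Both bases lie in the unit disc,
so the error is at most N |e^z - 1 - z| ≤ N |z|². An explicit rate is needed because the jump
measure will vary along the approximation. -/
theorem norm_charFun_binLaw_sub_le (hN : 0 < N) (h : 2 * η.real Set.univ ≤ N)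
    (t : EuclideanSpace ℝ (Fin d)) :
    ‖charFun (binLaw η N) t - Complex.exp (jumpExponent η t)‖ ≤
      (2 * η.real Set.univ) ^ 2 / N := by
  have hN' : (0 : ℝ) < N := by exact_mod_cast hN
  have hNC : (N : ℂ) ≠ 0 := by exact_mod_cast hN.ne'
  have h0 : 0 ≤ η.real Set.univ := measureReal_nonneg
  have hp := isProbabilityMeasure_binStep (η := η) hN (by linarith)
  have hx : ‖1 + jumpExponent η t / N‖ ≤ 1 := by
    rw [← charFun_binStep hN (by linarith)]
    exact norm_charFun_le_one t
  have hy : ‖Complex.exp (jumpExponent η t / N)‖ ≤ 1 := by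
    rw [Complex.norm_exp, Complex.div_natCast_re]
    exact Real.exp_le_one_iff.2 (div_nonpos_of_nonpos_of_nonneg (jumpExponent_re_nonpos t) hN'.le)
  have hexp : Complex.exp (jumpExponent η t) = Complex.exp (jumpExponent η t / N) ^ N := by
    rw [← Complex.exp_nat_mul, mul_div_cancel₀ _ hNC]
  have hz : ‖jumpExponent η t / N‖ ≤ 2 * η.real Set.univ / N := by
    rw [norm_div, Complex.norm_natCast]
    gcongr
    exact norm_jumpExponent_le t
  have hz1 : ‖jumpExponent η t / N‖ ≤ 1 := hz.trans (by rwa [div_le_one hN'])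
  rw [binLaw, charFun_convPow, charFun_binStep hN (by linarith), hexp]
  refine (norm_pow_sub_pow_le hx hy N).trans ?_
  rw [norm_sub_rev, ← sub_sub]
  calc (N : ℝ) * ‖Complex.exp (jumpExponent η t / N) - 1 - jumpExponent η t / N‖
      ≤ N * ‖jumpExponent η t / N‖ ^ 2 := by
        gcongr
        exact Complex.norm_exp_sub_one_sub_id_le hz1
    _ ≤ N * (2 * η.real Set.univ / N) ^ 2 := by gcongr
    _ = _ := by field_simp

/-- Keep only the outcomes with no jump, of weight a^n, and with exactly one, of weight n a^{n-1} ≥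
n a^n. -/
theorem le_lintegral_convPow (a : ENNReal) (ha : a ≤ 1) (σ : Measure (EuclideanSpace ℝ (Fin d)))
    [IsFiniteMeasure σ] [IsProbabilityMeasure (a • Measure.dirac 0 + σ)] (n : ℕ)
    {g : EuclideanSpace ℝ (Fin d) → ENNReal} (hg : Measurable g) :
    a ^ n * (g 0 + n * ∫⁻ u, g u ∂σ) ≤
      ∫⁻ u, g u ∂(convPow (a • Measure.dirac 0 + σ) n) := by
  induction n generalizing g with
  | zero => simp [convPow, lintegral_dirac' _ hg]
  | succ n ih =>
    rw [convPow, Measure.lintegral_conv hg]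
    have e : ∀ x, ∫⁻ y, g (x + y) ∂(a • Measure.dirac 0 + σ) =
        a * g x + ∫⁻ y, g (x + y) ∂σ := fun x => by
      rw [lintegral_add_measure, lintegral_smul_measure, lintegral_dirac' _ (by fun_prop)]
      simp
    simp only [e]
    have hm : Measurable fun x => ∫⁻ y, g (x + y) ∂σ :=
      Measurable.lintegral_prod_right' (f := fun z : EuclideanSpace ℝ (Fin d) ×
        EuclideanSpace ℝ (Fin d) => g (z.1 + z.2)) (by fun_prop)
    refine le_trans ?_ (ih (by fun_prop))
    calc a ^ (n + 1) * (g 0 + (n + 1 : ℕ) * ∫⁻ u, g u ∂σ)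
        = a ^ n * (a * g 0 + a * ∫⁻ u, g u ∂σ + n * (a * ∫⁻ u, g u ∂σ)) := by
          push_cast
          ring
      _ ≤ a ^ n * (a * g 0 + ∫⁻ y, g (0 + y) ∂σ +
            n * ∫⁻ u, (a * g u + ∫⁻ y, g (u + y) ∂σ) ∂σ) := by
          gcongr
          · simp only [zero_add]
            exact mul_le_of_le_one_left' ha
          · rw [← lintegral_const_mul _ hg]
            exact lintegral_mono fun u => le_self_add

theorem exp_neg_two_mul_le {x : ℝ} (h0 : 0 ≤ x) (h : x ≤ 1 / 2) : Real.exp (-(2 * x)) ≤ 1 - x := by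
  rw [Real.exp_neg, inv_le_comm₀ (Real.exp_pos _) (by linarith)]
  have h1 := Real.add_one_le_exp (2 * x)
  refine le_trans ?_ h1
  rw [inv_le_iff_one_le_mul₀ (by linarith)]
  nlinarith

/-- Lower bound for the binomial approximation by its atom and by its single jumps. -/
theorem le_lintegral_binLaw (hN : 0 < N) (h : 2 * η.real Set.univ ≤ N)
    {g : EuclideanSpace ℝ (Fin d) → ENNReal} (hg : Measurable g) :
    ENNReal.ofReal (Real.exp (-(2 * η.real Set.univ))) * (g 0 + ∫⁻ u, g u ∂η) ≤
      ∫⁻ u, g u ∂(binLaw η N) := by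
  have hN' : (0 : ℝ) < N := by exact_mod_cast hN
  have h0 : 0 ≤ η.real Set.univ := measureReal_nonneg
  have hp := isProbabilityMeasure_binStep (η := η) hN (by linarith)
  unfold binLaw
  unfold binStep at hp ⊢
  have hf : IsFiniteMeasure ((N : ENNReal)⁻¹ • η) := η.smul_finite (by simpa using hN.ne')
  refine le_trans ?_ (le_lintegral_convPow _ ?_ _ N hg)
  · rw [lintegral_smul_measure, smul_eq_mul, ← mul_assoc,
      ENNReal.mul_inv_cancel (by simpa using hN.ne') (by simp), one_mul]
    gcongr
    -- The N-th power of this bound is e^{-2m}, m the mass of η, uniformly in N.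
    have h1 : Real.exp (-(2 * (η.real Set.univ / N))) ≤ 1 - η.real Set.univ / N :=
      exp_neg_two_mul_le (by positivity) (by rw [div_le_iff₀ hN']; linarith)
    rw [← ENNReal.ofReal_pow ((Real.exp_pos _).le.trans h1)]
    refine ENNReal.ofReal_le_ofReal ?_
    refine le_trans (le_of_eq ?_) (pow_le_pow_left₀ (Real.exp_pos _).le h1 N)
    rw [← Real.exp_nat_mul]
    congr 1
    field_simp
  · refine ENNReal.ofReal_le_one.2 ?_
    have : 0 ≤ η.real Set.univ / N := by positivity
    linarith

end BinomialApproximation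

/-! ### Approximation of a Lévy measure by finite jump measures -/

section LevyApproximation

variable {d : ℕ} {ν : Measure (EuclideanSpace ℝ (Fin d))}

/-- Jumps of norm in `(1 / (n + 1), 1]`. -/
def smallJumps (d n : ℕ) : Set (EuclideanSpace ℝ (Fin d)) :=
  {u | 1 / ((n : ℝ) + 1) < ‖u‖ ∧ ‖u‖ ≤ 1}

/-- Jumps of norm larger than `1`. -/
def bigJumps (d : ℕ) : Set (EuclideanSpace ℝ (Fin d)) := {u | 1 < ‖u‖}

theorem measurableSet_smallJumps (n : ℕ) : MeasurableSet (smallJumps d n) :=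
  (measurableSet_lt measurable_const measurable_norm).inter
    (measurableSet_le measurable_norm measurable_const)

theorem measurableSet_bigJumps : MeasurableSet (bigJumps d) :=
  measurableSet_lt measurable_const measurable_norm

theorem disjoint_smallJumps_bigJumps (n : ℕ) : Disjoint (smallJumps d n) (bigJumps d) :=
  Set.disjoint_left.2 fun _ h h' => not_lt.2 h.2 h'

theorem smallJumps_union_bigJumps (n : ℕ) :
    smallJumps d n ∪ bigJumps d = {u | 1 / ((n : ℝ) + 1) < ‖u‖} := by
  have hn : 1 / ((n : ℝ) + 1) ≤ 1 := by
    rw [div_le_one (by positivity)]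
    linarith [(Nat.cast_nonneg n : (0 : ℝ) ≤ n)]
  ext u
  simp only [smallJumps, bigJumps, Set.mem_union, Set.mem_ofPred_eq]
  constructor
  · rintro (h | h)
    · exact h.1
    · exact hn.trans_lt h
  · intro h
    rcases le_or_gt ‖u‖ 1 with h1 | h1
    · exact Or.inl ⟨h, h1⟩
    · exact Or.inr h1

theorem IsLevyMeasure.measure_norm_gt_lt_top (h : IsLevyMeasure ν) {ε : ℝ} (hε : 0 < ε) :
    ν {u | ε < ‖u‖} < ⊤ := by
  refine (measure_mono fun u (hu : ε < ‖u‖) => ?_).trans_lt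
    (h.integrable_min.measure_ge_lt_top (ε := min 1 (ε ^ 2)) (by positivity))
  simp only [Set.mem_ofPred_eq]
  gcongr

theorem IsLevyMeasure.isFiniteMeasure_restrict (h : IsLevyMeasure ν) {ε : ℝ} (hε : 0 < ε)
    {s : Set (EuclideanSpace ℝ (Fin d))} (hs : ∀ u ∈ s, ε < ‖u‖) :
    IsFiniteMeasure (ν.restrict s) :=
  MeasureTheory.isFiniteMeasure_restrict.2 ((measure_mono fun u hu => hs u hu).trans_lt
    (h.measure_norm_gt_lt_top hε)).ne

theorem IsLevyMeasure.isFiniteMeasure_small (h : IsLevyMeasure ν) (n : ℕ) :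
    IsFiniteMeasure (ν.restrict (smallJumps d n)) :=
  h.isFiniteMeasure_restrict (ε := 1 / ((n : ℝ) + 1)) (by positivity) fun _ hu => hu.1

theorem IsLevyMeasure.isFiniteMeasure_big (h : IsLevyMeasure ν) :
    IsFiniteMeasure (ν.restrict (bigJumps d)) :=
  h.isFiniteMeasure_restrict one_pos fun _ hu => hu

/-- The drift of the law obtained by removing the jumps of norm at most `1 / (n + 1)`. -/
noncomputable def truncDrift (γ : EuclideanSpace ℝ (Fin d))
    (ν : Measure (EuclideanSpace ℝ (Fin d))) (n : ℕ) : EuclideanSpace ℝ (Fin d) :=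
  γ - ∫ u in smallJumps d n, u ∂ν

/-- On the small jumps the compensator is integrable and is absorbed into the drift; the big jumps
are not compensated. -/
theorem IsLevyMeasure.truncExponent_eq (h : IsLevyMeasure ν) (γ t : EuclideanSpace ℝ (Fin d))
    (n : ℕ) :
    Complex.I * ((inner ℝ t (truncDrift γ ν n) : ℝ) : ℂ) +
      jumpExponent (ν.restrict (smallJumps d n)) t + jumpExponent (ν.restrict (bigJumps d)) t =
    Complex.I * ((inner ℝ t γ : ℝ) : ℂ) +
      ∫ u in {u | 1 / ((n : ℝ) + 1) < ‖u‖}, levyKernel t u ∂ν := by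
  have f1 := h.isFiniteMeasure_small n
  have f2 := h.isFiniteMeasure_big
  have hid : Integrable (fun u => u) (ν.restrict (smallJumps d n)) :=
    Integrable.of_bound (by fun_prop) 1
      ((ae_restrict_iff' (measurableSet_smallJumps n)).2 (Filter.Eventually.of_forall
        fun u hu => hu.2))
  have hti : Integrable (fun u => ((inner ℝ t u : ℝ) : ℂ)) (ν.restrict (smallJumps d n)) :=
    (hid.const_inner t).ofReal
  have hK := h.integrable_levyKernel t
  rw [← smallJumps_union_bigJumps, setIntegral_union (disjoint_smallJumps_bigJumps n)
    measurableSet_bigJumps hK.integrableOn hK.integrableOn]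
  have e1 : ∫ u in smallJumps d n, levyKernel t u ∂ν =
      jumpExponent (ν.restrict (smallJumps d n)) t -
        Complex.I * ((inner ℝ t (∫ u in smallJumps d n, u ∂ν) : ℝ) : ℂ) := by
    rw [← integral_inner hid, ← integral_complex_ofReal, ← integral_const_mul, jumpExponent,
      ← integral_sub (integrable_jump t) (hti.const_mul _)]
    refine setIntegral_congr_fun (measurableSet_smallJumps n) fun u hu => ?_
    simp [levyKernel, hu.2]
  have e2 : ∫ u in bigJumps d, levyKernel t u ∂ν = jumpExponent (ν.restrict (bigJumps d)) t := by
    refine setIntegral_congr_fun measurableSet_bigJumps fun u hu => ?_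
    simp [levyKernel, not_le.2 (show 1 < ‖u‖ from hu)]
  rw [e1, e2, truncDrift, inner_sub_right]
  push_cast
  ring

theorem IsLevyMeasure.tendsto_setIntegral_levyKernel (h : IsLevyMeasure ν)
    (t : EuclideanSpace ℝ (Fin d)) :
    Filter.Tendsto (fun n : ℕ => ∫ u in {u | 1 / ((n : ℝ) + 1) < ‖u‖}, levyKernel t u ∂ν)
      Filter.atTop (nhds (∫ u, levyKernel t u ∂ν)) := by
  have hK := h.integrable_levyKernel t
  have hlim := tendsto_setIntegral_of_monotone (μ := ν) (f := levyKernel t)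
    (s := fun n : ℕ => {u : EuclideanSpace ℝ (Fin d) | 1 / ((n : ℝ) + 1) < ‖u‖})
    (fun n => measurableSet_lt measurable_const measurable_norm)
    (fun n m hnm u hu => lt_of_le_of_lt (one_div_le_one_div_of_le
      (by positivity : (0 : ℝ) < (n : ℝ) + 1) (by gcongr : (n : ℝ) + 1 ≤ m + 1)) hu)
    hK.integrableOn
  rwa [setIntegral_eq_integral_of_forall_compl_eq_zero] at hlim
  intro u hu
  have : u = 0 := by
    by_contra hne
    obtain ⟨n, hn⟩ := exists_nat_one_div_lt (norm_pos_iff.2 hne)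
    exact hu (Set.mem_iUnion.2 ⟨n, hn⟩)
  simp [this, levyKernel]

theorem norm_mul_mul_sub_le {w x y x' y' : ℂ} (hw : ‖w‖ ≤ 1) (hx' : ‖x'‖ ≤ 1)
    (hy : ‖y‖ ≤ 1) : ‖w * x * y - w * x' * y'‖ ≤ ‖x - x'‖ + ‖y - y'‖ := by
  have e : w * x * y - w * x' * y' = w * ((x - x') * y + x' * (y - y')) := by ring
  rw [e, norm_mul]
  refine (mul_le_of_le_one_left (norm_nonneg _) hw).trans ((norm_add_le _ _).trans ?_)
  rw [norm_mul, norm_mul]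
  exact add_le_add (mul_le_of_le_one_right (norm_nonneg _) hy)
    (mul_le_of_le_one_left (norm_nonneg _) hx')

/-- Laws `Y n ∗ W n` which satisfy modified logarithmic Sobolev inequalities and whose
characteristic functions converge to the one with exponent `levyExponent γ ν`. -/
theorem IsLevyMeasure.exists_approx (h : IsLevyMeasure ν) (γ : EuclideanSpace ℝ (Fin d)) :
    ∃ Y W : ℕ → Measure (EuclideanSpace ℝ (Fin d)),
      (∀ n, IsProbabilityMeasure (Y n)) ∧ (∀ n, IsProbabilityMeasure (W n)) ∧
      (∀ n, ∃ η, HasMLSI ((Y n).conv (W n)) η ∧ η ≤ (2 : ENNReal) • ν) ∧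
      (∀ t, Filter.Tendsto (fun n => charFun ((Y n).conv (W n)) t) Filter.atTop
        (nhds (Complex.exp (levyExponent γ ν t)))) ∧
      ∃ c : ENNReal, c ≠ 0 ∧ c ≠ ⊤ ∧ ∀ n, ∀ g : EuclideanSpace ℝ (Fin d) → ENNReal, Measurable g →
        c * (g 0 + ∫⁻ u in bigJumps d, g u ∂ν) ≤ ∫⁻ u, g u ∂(W n) := by
  have f1 := h.isFiniteMeasure_small
  have f2 := h.isFiniteMeasure_big
  set ηs : ℕ → Measure (EuclideanSpace ℝ (Fin d)) := fun n => ν.restrict (smallJumps d n) with hηs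
  set ηb : Measure (EuclideanSpace ℝ (Fin d)) := ν.restrict (bigJumps d) with hηb
  have f1' : ∀ n, IsFiniteMeasure (ηs n) := f1
  -- N is taken large enough for the atoms of both binomial laws to be at least 1/2 and for both
  -- characteristic function errors to be at most 1/(n + 1).
  have hNex : ∀ n : ℕ, ∃ N : ℕ, 0 < N ∧ 2 * (ηs n).real Set.univ ≤ N ∧
      2 * ηb.real Set.univ ≤ N ∧ (2 * (ηs n).real Set.univ) ^ 2 / N ≤ 1 / ((n : ℝ) + 1) ∧
      (2 * ηb.real Set.univ) ^ 2 / N ≤ 1 / ((n : ℝ) + 1) := fun n => by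
    obtain ⟨N, hN⟩ := exists_nat_ge (1 + 2 * (ηs n).real Set.univ + 2 * ηb.real Set.univ +
      ((n : ℝ) + 1) * (2 * (ηs n).real Set.univ) ^ 2 +
      ((n : ℝ) + 1) * (2 * ηb.real Set.univ) ^ 2)
    have p1 : 0 ≤ (ηs n).real Set.univ := measureReal_nonneg
    have p2 : 0 ≤ ηb.real Set.univ := measureReal_nonneg
    have p3 : 0 ≤ ((n : ℝ) + 1) * (2 * (ηs n).real Set.univ) ^ 2 := by positivity
    have p4 : 0 ≤ ((n : ℝ) + 1) * (2 * ηb.real Set.univ) ^ 2 := by positivity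
    have hpos : (0 : ℝ) < N := by linarith
    refine ⟨N, by exact_mod_cast hpos, by linarith, by linarith, ?_, ?_⟩ <;>
    · rw [div_le_div_iff₀ hpos (by positivity)]
      linarith
  choose N hN0 hNs hNb hNs2 hNb2 using hNex
  have pS : ∀ n, IsProbabilityMeasure (binLaw (ηs n) (N n)) := fun n => by
    have := isProbabilityMeasure_binStep (η := ηs n) (hN0 n)
      (by linarith [hNs n, (measureReal_nonneg : 0 ≤ (ηs n).real Set.univ)])
    unfold binLaw
    infer_instance
  have pB : ∀ n, IsProbabilityMeasure (binLaw ηb (N n)) := fun n => by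
    have := isProbabilityMeasure_binStep (η := ηb) (hN0 n)
      (by linarith [hNb n, (measureReal_nonneg : 0 ≤ ηb.real Set.univ)])
    unfold binLaw
    infer_instance
  -- The big jumps form a separate factor because their jump measure does not depend on n, so the
  -- constant in the lower bound is uniform in n.
  refine ⟨fun n => (Measure.dirac (truncDrift γ ν n)).conv (binLaw (ηs n) (N n)),
    fun n => binLaw ηb (N n), fun n => inferInstance, pB, fun n => ?_, fun t => ?_,
    ENNReal.ofReal (Real.exp (-(2 * ηb.real Set.univ))), ?_, by simp, fun n g hg => ?_⟩
  · obtain ⟨η₁, s1, m1, l1⟩ := hasMLSI_binLaw (hN0 n) (hNs n)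
    obtain ⟨η₂, s2, m2, l2⟩ := hasMLSI_binLaw (hN0 n) (hNb n)
    refine ⟨0 + η₁ + η₂, ((hasMLSI_dirac _).conv m1).conv m2, ?_⟩
    rw [zero_add]
    refine (add_le_add l1 l2).trans ?_
    rw [← smul_add, hηs, hηb, ← Measure.restrict_union (disjoint_smallJumps_bigJumps n)
      measurableSet_bigJumps]
    refine Measure.le_intro fun s _ _ => ?_
    simp only [Measure.smul_apply, smul_eq_mul]
    gcongr
    exact Measure.restrict_le_self
  · have hexpo := (h.tendsto_setIntegral_levyKernel t).const_add
      (Complex.I * ((inner ℝ t γ : ℝ) : ℂ))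
    simp only [← h.truncExponent_eq γ t, ← levyExponent_eq] at hexpo
    have hexp := (Complex.continuous_exp.tendsto _).comp hexpo
    have hdiff : Filter.Tendsto (fun n => charFun
        (((Measure.dirac (truncDrift γ ν n)).conv (binLaw (ηs n) (N n))).conv (binLaw ηb (N n))) t -
        Complex.exp (Complex.I * ((inner ℝ t (truncDrift γ ν n) : ℝ) : ℂ) +
          jumpExponent (ηs n) t + jumpExponent ηb t)) Filter.atTop (nhds 0) := by
      have hz : Filter.Tendsto (fun n : ℕ => 2 * (1 / ((n : ℝ) + 1))) Filter.atTop (nhds 0) := by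
        simpa using (tendsto_one_div_add_atTop_nhds_zero_nat (𝕜 := ℝ)).const_mul 2
      refine squeeze_zero_norm (fun n => ?_) hz
      rw [charFun_conv, charFun_conv, charFun_dirac, Complex.exp_add, Complex.exp_add,
        mul_comm Complex.I, real_inner_comm]
      have hJ : ‖Complex.exp (jumpExponent (ηs n) t)‖ ≤ 1 := by
        rw [Complex.norm_exp]
        exact Real.exp_le_one_iff.2 (jumpExponent_re_nonpos t)
      refine (norm_mul_mul_sub_le (Complex.norm_exp_ofReal_mul_I _).le hJ
        (norm_charFun_le_one t)).trans ?_
      have b1 := norm_charFun_binLaw_sub_le (hN0 n) (hNs n) t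
      have b2 := norm_charFun_binLaw_sub_le (hN0 n) (hNb n) t
      linarith [hNs2 n, hNb2 n]
    have := hdiff.add hexp
    rw [zero_add] at this
    exact this.congr fun n => sub_add_cancel _ _
  · simpa using Real.exp_pos _
  · exact le_lintegral_binLaw (hN0 n) (hNb n) hg

end LevyApproximation

/-! ### Passage to the weak limit -/

section WeakLimit

variable {d : ℕ} {ν : Measure (EuclideanSpace ℝ (Fin d))}

theorem tendsto_integral_of_tendsto_charFun {μ : ℕ → Measure (EuclideanSpace ℝ (Fin d))}
    {μ₀ : Measure (EuclideanSpace ℝ (Fin d))} [∀ n, IsProbabilityMeasure (μ n)]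
    [IsProbabilityMeasure μ₀]
    (h : ∀ t, Filter.Tendsto (fun n => charFun (μ n) t) Filter.atTop (nhds (charFun μ₀ t)))
    {f : EuclideanSpace ℝ (Fin d) → ℝ} (hf : Continuous f) {C : ℝ} (hC : ∀ x, |f x| ≤ C) :
    Filter.Tendsto (fun n => ∫ x, f x ∂(μ n)) Filter.atTop (nhds (∫ x, f x ∂μ₀)) := by
  have h1 := ProbabilityMeasure.tendsto_of_tendsto_charFun
    (μ := fun n => (⟨μ n, inferInstance⟩ : ProbabilityMeasure _)) (μ₀ := ⟨μ₀, inferInstance⟩) h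
  exact ProbabilityMeasure.tendsto_iff_forall_integral_tendsto.1 h1
    (BoundedContinuousFunction.ofNormedAddCommGroup f hf C hC)

/-- A continuous cutoff function vanishing on the ball of radius `R`, equal to `1` outside the ball
of radius `R + 1`. -/
noncomputable def cutoff (R : ℝ) (x : EuclideanSpace ℝ (Fin d)) : ℝ := min 1 (max 0 (‖x‖ - R))

theorem continuous_cutoff (R : ℝ) :
    Continuous (cutoff R : EuclideanSpace ℝ (Fin d) → ℝ) := by
  unfold cutoff; fun_prop

theorem cutoff_nonneg (R : ℝ) (x : EuclideanSpace ℝ (Fin d)) : 0 ≤ cutoff R x :=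
  le_min zero_le_one (le_max_left _ _)

theorem abs_cutoff_le (R : ℝ) (x : EuclideanSpace ℝ (Fin d)) : |cutoff R x| ≤ 1 := by
  rw [abs_of_nonneg (cutoff_nonneg R x)]
  exact min_le_left _ _

theorem tendsto_integral_cutoff (μ : Measure (EuclideanSpace ℝ (Fin d)))
    [IsProbabilityMeasure μ] :
    Filter.Tendsto (fun n : ℕ => ∫ x, cutoff (n : ℝ) x ∂μ) Filter.atTop (nhds 0) := by
  have := tendsto_integral_of_dominated_convergence (μ := μ)
    (F := fun (n : ℕ) x => cutoff (n : ℝ) x) (f := fun _ => 0) (fun _ => 1)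
    (fun n => (continuous_cutoff _).aestronglyMeasurable) (integrable_const _)
    (fun n => Filter.Eventually.of_forall fun x => abs_cutoff_le _ x)
    (Filter.Eventually.of_forall fun x => ?_)
  · simpa using this
  · obtain ⟨N, hN⟩ := exists_nat_ge ‖x‖
    refine tendsto_const_nhds.congr' ?_
    filter_upwards [Filter.eventually_ge_atTop N] with n hn
    have : ‖x‖ ≤ n := hN.trans (by exact_mod_cast hn)
    rw [cutoff, max_eq_left (by linarith), min_eq_right zero_le_one]

/-- If `Y n ∗ W n` converges weakly and `W n` has an atom at `0` of mass at least `c`, then `Y n`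
charges some fixed ball. -/
theorem exists_ball_half_le {Y W : ℕ → Measure (EuclideanSpace ℝ (Fin d))}
    {μ₀ : Measure (EuclideanSpace ℝ (Fin d))} [∀ n, IsProbabilityMeasure (Y n)]
    [∀ n, IsProbabilityMeasure (W n)] [IsProbabilityMeasure μ₀]
    (h : ∀ t, Filter.Tendsto (fun n => charFun ((Y n).conv (W n)) t) Filter.atTop
      (nhds (charFun μ₀ t)))
    {c : ENNReal} (hc0 : c ≠ 0) (hct : c ≠ ⊤)
    (hW : ∀ n, ∀ g : EuclideanSpace ℝ (Fin d) → ENNReal, Measurable g →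
      c * g 0 ≤ ∫⁻ u, g u ∂(W n)) :
    ∃ R : ℝ, ∀ᶠ n in Filter.atTop, 1 / 2 ≤ Y n {y | ‖y‖ ≤ R} := by
  -- The atom of `W n` gives c · `Y n`(‖y‖ > R + 1) ≤ ∫ cutoff d(`Y n` ∗ `W n`). Making the limit of
  -- the right side smaller than c/2 leaves mass at most 1/2 outside the ball.
  have hcpos : 0 < c.toReal / 2 := half_pos (ENNReal.toReal_pos hc0 hct)
  obtain ⟨R, hR⟩ := ((tendsto_integral_cutoff μ₀).eventually (gt_mem_nhds hcpos)).exists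
  refine ⟨R + 1, ?_⟩
  have hlim := tendsto_integral_of_tendsto_charFun h (continuous_cutoff (R : ℝ)) (abs_cutoff_le _)
  filter_upwards [hlim.eventually (gt_mem_nhds hR)] with n hn
  have hs : MeasurableSet {y : EuclideanSpace ℝ (Fin d) | ‖y‖ ≤ (R : ℝ) + 1} :=
    measurableSet_le measurable_norm measurable_const
  have hm : Measurable fun x : EuclideanSpace ℝ (Fin d) => ENNReal.ofReal (cutoff (R : ℝ) x) :=
    (continuous_cutoff _).measurable.ennreal_ofReal
  have h1 : c * Y n {y | ‖y‖ ≤ (R : ℝ) + 1}ᶜ ≤ c * (1 / 2) := by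
    calc c * Y n {y | ‖y‖ ≤ (R : ℝ) + 1}ᶜ
        = c * ∫⁻ y, Set.indicator {y | ‖y‖ ≤ (R : ℝ) + 1}ᶜ 1 y ∂(Y n) := by
          rw [lintegral_indicator_one hs.compl]
      _ ≤ c * ∫⁻ y, ENNReal.ofReal (cutoff R y) ∂(Y n) := by
          gcongr with y
          rcases le_or_gt ‖y‖ ((R : ℝ) + 1) with hy | hy
          · simp [hy]
          · rw [cutoff, max_eq_right (by linarith), min_eq_left (by linarith)]
            simp [hy]
      _ = ∫⁻ y, c * ENNReal.ofReal (cutoff R (y + 0)) ∂(Y n) := by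
          rw [lintegral_const_mul _ (by simpa using hm)]
          simp
      _ ≤ ∫⁻ y, ∫⁻ w, ENNReal.ofReal (cutoff R (y + w)) ∂(W n) ∂(Y n) :=
          lintegral_mono fun y =>
            hW n (fun w => ENNReal.ofReal (cutoff R (y + w))) (hm.comp (measurable_const_add y))
      _ = ENNReal.ofReal (∫ x, cutoff R x ∂((Y n).conv (W n))) := by
          rw [← Measure.lintegral_conv hm, ofReal_integral_eq_lintegral_ofReal
            (integrable_of_bounded (continuous_cutoff _).measurable (abs_cutoff_le _))
            (Filter.Eventually.of_forall fun x => cutoff_nonneg _ x)]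
      _ ≤ ENNReal.ofReal (c.toReal / 2) := ENNReal.ofReal_le_ofReal hn.le
      _ = c * (1 / 2) := by
          rw [ENNReal.ofReal_div_of_pos two_pos, ENNReal.ofReal_toReal hct]
          simp [div_eq_mul_inv]
  have h2 : Y n {y | ‖y‖ ≤ (R : ℝ) + 1}ᶜ ≤ 1 / 2 := (ENNReal.mul_le_mul_iff_right hc0 hct).1 h1
  rw [prob_compl_eq_one_sub hs, tsub_le_iff_right] at h2
  have h3 : (1 / 2 : ENNReal) + 1 / 2 ≤ 1 / 2 + Y n {y | ‖y‖ ≤ (R : ℝ) + 1} := by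
    rwa [ENNReal.add_halves]
  exact (ENNReal.add_le_add_iff_left (by simp)).1 h3

variable {Ω : Type*} [MeasurableSpace Ω] {P : Measure Ω} [IsProbabilityMeasure P]
  {X : Ω → EuclideanSpace ℝ (Fin d)} {γ : EuclideanSpace ℝ (Fin d)}

/-- Exponential moments of the components pass to the large jumps of the Lévy measure. -/
theorem IsIDVector.integrableOn_exp_bigJumps (hX : IsIDVector P X γ ν) {t : ℝ} (ht : 0 ≤ t)
    {k : Fin d} (hexp : Integrable (fun ω => Real.exp (t * |X ω k|)) P) :
    IntegrableOn (fun u => Real.exp (t * |u k|)) (bigJumps d) ν := by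
  have pX : IsProbabilityMeasure (P.map X) := Measure.isProbabilityMeasure_map hX.aemeasurable
  obtain ⟨Y, W, pY, pW, -, hchar, c, hc0, hct, hc⟩ := hX.levy.exists_approx γ
  simp only [← hX.charFun_eq] at hchar
  obtain ⟨R, hR⟩ := exists_ball_half_le hchar hc0 hct
    fun n g hg => (by gcongr; exact le_self_add : c * g 0 ≤ _).trans (hc n g hg)
  set g : ℕ → EuclideanSpace ℝ (Fin d) → ℝ := fun K x => min (Real.exp (t * |x k|)) K with hg
  have hgc : ∀ K, Continuous (g K) := fun K => by fun_prop
  have hg0 : ∀ K x, 0 ≤ g K x := fun K x => le_min (Real.exp_pos _).le (Nat.cast_nonneg K)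
  have hgb : ∀ K x, |g K x| ≤ K := fun K x => by
    rw [abs_of_nonneg (hg0 K x)]
    exact min_le_right _ _
  -- When ‖y‖ ≤ R, adding y lowers |u_k| by at most R, whence the factor e^{-tR}. Truncation at K
  -- keeps `g` bounded and continuous for weak convergence; K → ∞ follows by Fatou.
  set q : ℕ → EuclideanSpace ℝ (Fin d) → ℝ :=
    fun K x => min (Real.exp (-(t * R)) * Real.exp (t * |x k|)) K with hq
  have hqm : ∀ K, Measurable (q K) := fun K => by fun_prop
  have hqg : ∀ K y u, ‖y‖ ≤ R → q K u ≤ g K (y + u) := fun K y u hy => by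
    refine min_le_min_right _ ?_
    rw [← Real.exp_add]
    refine Real.exp_le_exp.2 ?_
    have h1 : |y k| ≤ R := (PiLp.norm_apply_le y k).trans hy
    have h2 : |u k| ≤ |(y + u) k| + |y k| := by
      have := abs_sub ((y + u) k) (y k)
      simpa using this
    nlinarith
  have hbound : ∀ K, c * (1 / 2 * ∫⁻ u in bigJumps d, ENNReal.ofReal (q K u) ∂ν) ≤
      ENNReal.ofReal (∫ ω, Real.exp (t * |X ω k|) ∂P) := fun K => by
    have hlim := tendsto_integral_of_tendsto_charFun hchar (hgc K) (hgb K)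
    have hle : ∫ x, g K x ∂(P.map X) ≤ ∫ ω, Real.exp (t * |X ω k|) ∂P := by
      rw [integral_map hX.aemeasurable (hgc K).aestronglyMeasurable]
      refine integral_mono_of_nonneg (Filter.Eventually.of_forall fun ω => hg0 K _) hexp
        (Filter.Eventually.of_forall fun ω => min_le_left _ _)
    refine le_trans ?_ (ENNReal.ofReal_le_ofReal hle)
    refine ge_of_tendsto (ENNReal.tendsto_ofReal hlim) ?_
    filter_upwards [hR] with n hn
    have hgm : Measurable fun x => ENNReal.ofReal (g K x) := (hgc K).measurable.ennreal_ofReal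
    have hs : MeasurableSet {y : EuclideanSpace ℝ (Fin d) | ‖y‖ ≤ R} :=
      measurableSet_le measurable_norm measurable_const
    rw [ofReal_integral_eq_lintegral_ofReal (integrable_of_bounded (hgc K).measurable (hgb K))
      (Filter.Eventually.of_forall fun x => hg0 K x), Measure.lintegral_conv hgm]
    calc c * (1 / 2 * ∫⁻ u in bigJumps d, ENNReal.ofReal (q K u) ∂ν)
        ≤ c * (Y n {y | ‖y‖ ≤ R} * ∫⁻ u in bigJumps d, ENNReal.ofReal (q K u) ∂ν) := by gcongr
      _ = ∫⁻ _ in {y | ‖y‖ ≤ R}, (c * ∫⁻ u in bigJumps d, ENNReal.ofReal (q K u) ∂ν) ∂(Y n) := by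
          rw [setLIntegral_const]
          ring
      _ ≤ ∫⁻ y in {y | ‖y‖ ≤ R}, (∫⁻ w, ENNReal.ofReal (g K (y + w)) ∂(W n)) ∂(Y n) := by
          refine setLIntegral_mono' hs fun y hy => ?_
          refine le_trans ?_ (hc n (fun w => ENNReal.ofReal (g K (y + w))) (by fun_prop))
          gcongr
          refine le_trans (lintegral_mono fun u => ?_) le_add_self
          exact ENNReal.ofReal_le_ofReal (hqg K y u hy)
      _ ≤ _ := setLIntegral_le_lintegral _ _
  have hfatou : ∫⁻ u in bigJumps d, ENNReal.ofReal (Real.exp (-(t * R)) * Real.exp (t * |u k|)) ∂ν ≤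
      (c * (1 / 2))⁻¹ * ENNReal.ofReal (∫ ω, Real.exp (t * |X ω k|) ∂P) := by
    have hlimq : ∀ u, Filter.Tendsto (fun K => ENNReal.ofReal (q K u)) Filter.atTop
        (nhds (ENNReal.ofReal (Real.exp (-(t * R)) * Real.exp (t * |u k|)))) := fun u => by
      refine tendsto_const_nhds.congr' ?_
      obtain ⟨N, hN⟩ := exists_nat_ge (Real.exp (-(t * R)) * Real.exp (t * |u k|))
      filter_upwards [Filter.eventually_ge_atTop N] with K hK
      rw [hq]
      simp only
      rw [min_eq_left (hN.trans (by exact_mod_cast hK))]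
    calc ∫⁻ u in bigJumps d, ENNReal.ofReal (Real.exp (-(t * R)) * Real.exp (t * |u k|)) ∂ν
        = ∫⁻ u in bigJumps d, Filter.liminf (fun K => ENNReal.ofReal (q K u)) Filter.atTop ∂ν := by
          simp only [(hlimq _).liminf_eq]
      _ ≤ Filter.liminf (fun K => ∫⁻ u in bigJumps d, ENNReal.ofReal (q K u) ∂ν) Filter.atTop :=
          lintegral_liminf_le fun K => (hqm K).ennreal_ofReal
      _ ≤ _ := by
          refine Filter.liminf_le_of_le (by isBoundedDefault) fun b hb => ?_
          obtain ⟨K, hK⟩ := hb.exists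
          refine hK.trans ?_
          have hne : c * (1 / 2) ≠ 0 := mul_ne_zero hc0 (by simp)
          have hnt : c * (1 / 2) ≠ ⊤ := ENNReal.mul_ne_top hct (by simp)
          have := hbound K
          rw [← mul_assoc] at this
          calc _ = (c * (1 / 2))⁻¹ * (c * (1 / 2) *
                ∫⁻ u in bigJumps d, ENNReal.ofReal (q K u) ∂ν) := by
                rw [← mul_assoc, ENNReal.inv_mul_cancel hne hnt, one_mul]
            _ ≤ _ := by gcongr
  have hint : IntegrableOn (fun u => Real.exp (-(t * R)) * Real.exp (t * |u k|)) (bigJumps d) ν := by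
    refine ⟨by fun_prop, ?_⟩
    rw [hasFiniteIntegral_iff_ofReal (Filter.Eventually.of_forall fun u => by positivity)]
    refine hfatou.trans_lt (ENNReal.mul_lt_top ?_ ENNReal.ofReal_lt_top)
    exact ENNReal.inv_lt_top.2 (pos_iff_ne_zero.2 (mul_ne_zero hc0 (by simp)))
  have := hint.const_mul (Real.exp (t * R))
  refine this.congr (Filter.Eventually.of_forall fun u => ?_)
  simp only
  rw [← mul_assoc, ← Real.exp_add]
  simp

/-- Exponential bound for bounded functionals of an infinitely divisible vector whose increments
are dominated by those of the smoothed norm of the projection. -/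
theorem IsIDVector.integral_exp_le (hX : IsIDVector P X γ ν) (hax : OnAxes ν)
    {S : Submodule ℝ (EuclideanSpace ℝ (Fin d))} {E T : ℝ} (hE : 0 < E) (hT : 0 < T)
    (hI : ∀ t ∈ Set.Icc 0 T, HFunIntegrable ν t)
    (hcont : ContinuousOn (hFun ν S E) (Set.Icc 0 T))
    (hG : ∀ t ∈ Set.Icc 0 T, ∫ s in (0 : ℝ)..t, hFun ν S E s ≤ t * hFun ν S E t / 2)
    {f : EuclideanSpace ℝ (Fin d) → ℝ} (hfc : Continuous f) {C : ℝ} (hC : ∀ x, |f x| ≤ C)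
    (hf : ∀ x u, |f (x + u) - f x| ≤
      |smoothNorm E (S.starProjection (x + u)) - smoothNorm E (S.starProjection x)|) :
    ∫ ω, Real.exp (T * f (X ω)) ∂P ≤
      Real.exp (T * ∫ ω, f (X ω) ∂P + ∫ s in (0 : ℝ)..T, hFun ν S E s) := by
  have pX : IsProbabilityMeasure (P.map X) := Measure.isProbabilityMeasure_map hX.aemeasurable
  obtain ⟨Y, W, pY, pW, hmls, hchar, -⟩ := hX.levy.exists_approx γ
  simp only [← hX.charFun_eq] at hchar
  have l1 := tendsto_integral_of_tendsto_charFun hchar hfc hC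
  have l2 := tendsto_integral_of_tendsto_charFun hchar (f := fun x => Real.exp (T * f x))
    (by fun_prop) (C := Real.exp (T * C)) fun x =>
      abs_exp_le (by rw [abs_mul, abs_of_pos hT]; gcongr; exact hC x)
  rw [integral_map hX.aemeasurable (by fun_prop)] at l1 l2
  have l3 := (Real.continuous_exp.tendsto _).comp
    ((l1.const_mul T).add_const (∫ s in (0 : ℝ)..T, hFun ν S E s))
  -- The exponential bound itself, not the Sobolev inequality, passes to the limit. Its term ∫ h is
  -- the same for all n because every jump measure is at most 2ν.
  refine le_of_tendsto_of_tendsto' l2 l3 fun n => ?_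
  obtain ⟨η, hη, hle⟩ := hmls n
  exact integral_exp_le_of_entExp_le hfc.measurable hC hT hcont
    (fun t ht => hFun_nonneg ht.1) hG fun t ht =>
      entExp_mul_le hax hE ht.1.le (hI t (Set.Ioo_subset_Icc_self ht)) hη hle hfc.measurable hC hf

end WeakLimit

/-! ### Finiteness, continuity and monotonicity of h -/

section HFunction

variable {d : ℕ} {ν : Measure (EuclideanSpace ℝ (Fin d))}
  {S : Submodule ℝ (EuclideanSpace ℝ (Fin d))} {E : ℝ}

/-- The power is paid for by raising the exponent from s to t, for which there is room strictly
below M. -/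
theorem pow_mul_exp_le {x s t : ℝ} (hx : 0 ≤ x) (hst : s < t) (p : ℕ) :
    x ^ p * Real.exp (s * x) ≤ p.factorial / (t - s) ^ p * Real.exp (t * x) := by
  have hδ : 0 < t - s := sub_pos.2 hst
  have h1 := Real.pow_div_factorial_le_exp ((t - s) * x) (by positivity) p
  have h2 : x ^ p ≤ p.factorial / (t - s) ^ p * Real.exp ((t - s) * x) := by
    rw [div_mul_eq_mul_div, le_div_iff₀ (by positivity)]
    rw [div_le_iff₀ (by positivity), mul_pow] at h1
    linarith
  calc x ^ p * Real.exp (s * x)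
      ≤ p.factorial / (t - s) ^ p * Real.exp ((t - s) * x) * Real.exp (s * x) := by gcongr
    _ = _ := by
        rw [mul_assoc, ← Real.exp_add]
        ring_nf

/-- Near the origin e^{s|u_k|} - 1 is O(|u_k|), so p ≥ 1 makes the integrand O(‖u‖²); on the big
jumps the exponential moment at t > s suffices. -/
theorem IsLevyMeasure.integrable_pow_mul_exp_sub_one (h : IsLevyMeasure ν) {s t : ℝ} (hs : 0 ≤ s)
    (hst : s < t) {k : Fin d}
    (hexp : IntegrableOn (fun u => Real.exp (t * |u k|)) (bigJumps d) ν) {p : ℕ} (hp : 1 ≤ p) :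
    Integrable (fun u => |u k| ^ p * (Real.exp (s * |u k|) - 1)) ν := by
  have hmeas : AEStronglyMeasurable (fun u => |u k| ^ p * (Real.exp (s * |u k|) - 1)) ν := by
    have : Measurable fun u : EuclideanSpace ℝ (Fin d) =>
      |u k| ^ p * (Real.exp (s * |u k|) - 1) := by fun_prop
    exact this.aestronglyMeasurable
  have hdom : Integrable (fun u => s * Real.exp s * min 1 (‖u‖ ^ 2) +
      (bigJumps d).indicator
        (fun u => p.factorial / (t - s) ^ p * Real.exp (t * |u k|)) u) ν :=
    (h.integrable_min.const_mul _).add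
      ((integrable_indicator_iff measurableSet_bigJumps).2 (hexp.const_mul _))
  refine hdom.mono' hmeas (Filter.Eventually.of_forall fun u => ?_)
  have hk : |u k| ≤ ‖u‖ := PiLp.norm_apply_le u k
  have hnn : 0 ≤ Real.exp (s * |u k|) - 1 := exp_sub_one_nonneg (by positivity)
  rw [Real.norm_of_nonneg (by positivity)]
  by_cases hu : u ∈ bigJumps d
  · rw [Set.indicator_of_mem hu]
    refine le_trans ?_ (le_add_of_nonneg_left (by positivity))
    refine le_trans ?_ (pow_mul_exp_le (abs_nonneg _) hst p)
    gcongr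
    linarith
  · rw [Set.indicator_of_notMem hu, add_zero]
    have hu1 : ‖u‖ ≤ 1 := not_lt.1 hu
    rw [min_eq_right (pow_le_one₀ (norm_nonneg u) hu1)]
    have h1 : |u k| ^ p ≤ |u k| := pow_le_of_le_one (abs_nonneg _) (hk.trans hu1) (by omega)
    have h2 : Real.exp (s * |u k|) - 1 ≤ s * |u k| * Real.exp s := by
      have h3 := Real.add_one_le_exp (-(s * |u k|))
      have h4 : Real.exp (s * |u k|) * Real.exp (-(s * |u k|)) = 1 := by
        rw [← Real.exp_add]; simp
      have h5 : Real.exp (s * |u k|) ≤ Real.exp s :=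
        Real.exp_le_exp.2 (mul_le_of_le_one_right hs (hk.trans hu1))
      have h6 := mul_le_mul_of_nonneg_left h3 (Real.exp_pos (s * |u k|)).le
      have h7 : s * |u k| * Real.exp (s * |u k|) ≤ s * |u k| * Real.exp s := by gcongr
      nlinarith
    calc |u k| ^ p * (Real.exp (s * |u k|) - 1) ≤ |u k| * (s * |u k| * Real.exp s) := by gcongr
      _ = s * Real.exp s * |u k| ^ 2 := by ring
      _ ≤ s * Real.exp s * ‖u‖ ^ 2 := by gcongr

theorem IsLevyMeasure.hFunIntegrable (h : IsLevyMeasure ν) {s t : ℝ} (hs : 0 ≤ s) (hst : s < t)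
    (hexp : ∀ k, IntegrableOn (fun u => Real.exp (t * |u k|)) (bigJumps d) ν) :
    HFunIntegrable ν s := fun k => by
  constructor
  · refine (integrable_axisLevyMeasure_iff (by fun_prop) (by simp)).2 ?_
    simpa using h.integrable_pow_mul_exp_sub_one hs hst (hexp k) le_rfl
  · exact (integrable_axisLevyMeasure_iff (by fun_prop) (by simp)).2
      (h.integrable_pow_mul_exp_sub_one hs hst (hexp k) (by norm_num))

theorem continuousOn_integral_mul_exp_sub_one {m : Measure ℝ} {w : ℝ → ℝ} (hw : Measurable w)
    (hw0 : ∀ u, 0 ≤ w u) {T : ℝ}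
    (hi : Integrable (fun u => w u * (Real.exp (T * |u|) - 1)) m) :
    ContinuousOn (fun t => ∫ u, w u * (Real.exp (t * |u|) - 1) ∂m) (Set.Icc 0 T) := by
  refine continuousOn_of_dominated (fun t _ => ?_) (fun t ht => ?_) hi ?_
  · exact (by fun_prop : Measurable _).aestronglyMeasurable
  · refine Filter.Eventually.of_forall fun u => ?_
    have : 0 ≤ Real.exp (t * |u|) - 1 := exp_sub_one_nonneg (mul_nonneg ht.1 (abs_nonneg u))
    have h0 := hw0 u
    rw [Real.norm_of_nonneg (by positivity)]
    gcongr
    exact ht.2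
  · exact Filter.Eventually.of_forall fun u => by fun_prop

theorem continuousOn_ciSup_fin {d : ℕ} {B : Fin d → ℝ → ℝ} {s : Set ℝ}
    (hB : ∀ k, ContinuousOn (B k) s) : ContinuousOn (fun t => ⨆ k, B k t) s := by
  rcases isEmpty_or_nonempty (Fin d) with hd | hd
  · simp only [Real.iSup_of_isEmpty]
    exact continuousOn_const
  · simp only [← Finset.sup'_univ_eq_ciSup]
    exact ContinuousOn.finset_sup'_apply _ fun k _ => hB k

theorem continuousOn_hFun {T : ℝ} (hI : HFunIntegrable ν T) :
    ContinuousOn (hFun ν S E) (Set.Icc 0 T) := by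
  unfold hFun
  refine ContinuousOn.add (ContinuousOn.mul continuousOn_const (continuousOn_ciSup_fin fun k =>
    continuousOn_integral_mul_exp_sub_one (by fun_prop) (fun u => abs_nonneg u) (hI k).1))
    (ContinuousOn.mul continuousOn_const (continuousOn_finsetSum _ fun k _ =>
      ContinuousOn.mul continuousOn_const
        (continuousOn_integral_mul_exp_sub_one (by fun_prop) (fun u => by positivity) (hI k).2)))

theorem hFun_zero : hFun ν S E 0 = 0 := by
  simp [hFun]

theorem integral_mul_exp_sub_one_le {m : Measure ℝ} {w : ℝ → ℝ} (hw0 : ∀ u, 0 ≤ w u) {s t : ℝ}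
    (hs : 0 ≤ s) (hst : s ≤ t)
    (his : Integrable (fun u => w u * (Real.exp (s * |u|) - 1)) m)
    (hit : Integrable (fun u => w u * (Real.exp (t * |u|) - 1)) m) :
    t * ∫ u, w u * (Real.exp (s * |u|) - 1) ∂m ≤ s * ∫ u, w u * (Real.exp (t * |u|) - 1) ∂m := by
  rw [← integral_const_mul, ← integral_const_mul]
  refine integral_mono (his.const_mul _) (hit.const_mul _) fun u => ?_
  rcases eq_or_ne u 0 with rfl | hu
  · simp
  have hu' : 0 < |u| := abs_pos.2 hu
  have h1 := exp_sub_one_mul_le (by positivity : 0 ≤ s * |u|) (by gcongr : s * |u| ≤ t * |u|)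
  have h2 : (Real.exp (s * |u|) - 1) * t ≤ s * (Real.exp (t * |u|) - 1) := by
    refine le_of_mul_le_mul_right ?_ hu'
    linarith
  have := mul_le_mul_of_nonneg_left h2 (hw0 u)
  simp only
  linarith

/-- `h(t) / t` is nondecreasing. -/
theorem mul_hFun_le {s t : ℝ} (hs : 0 ≤ s) (hst : s ≤ t) (his : HFunIntegrable ν s)
    (hit : HFunIntegrable ν t) : t * hFun ν S E s ≤ s * hFun ν S E t := by
  have ht := hs.trans hst
  have h1 : t * (⨆ k : Fin d, ∫ u, |u| * (Real.exp (s * |u|) - 1) ∂(axisLevyMeasure ν k)) ≤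
      s * ⨆ k : Fin d, ∫ u, |u| * (Real.exp (t * |u|) - 1) ∂(axisLevyMeasure ν k) := by
    rw [Real.mul_iSup_of_nonneg ht, Real.mul_iSup_of_nonneg hs]
    exact ciSup_mono (Set.finite_range _).bddAbove fun k =>
      integral_mul_exp_sub_one_le (fun u => abs_nonneg u) hs hst (his k).1 (hit k).1
  have h2 : t * ∑ k : Fin d, ‖S.starProjection (EuclideanSpace.single k (1 : ℝ))‖ ^ 4 *
        ∫ u, |u| ^ 3 * (Real.exp (s * |u|) - 1) ∂(axisLevyMeasure ν k) ≤
      s * ∑ k : Fin d, ‖S.starProjection (EuclideanSpace.single k (1 : ℝ))‖ ^ 4 *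
        ∫ u, |u| ^ 3 * (Real.exp (t * |u|) - 1) ∂(axisLevyMeasure ν k) := by
    rw [Finset.mul_sum, Finset.mul_sum]
    refine Finset.sum_le_sum fun k _ => ?_
    rw [mul_left_comm, mul_left_comm s]
    refine mul_le_mul_of_nonneg_left ?_ (by positivity)
    exact integral_mul_exp_sub_one_le (fun u => by positivity) hs hst (his k).2 (hit k).2
  have h3 : 0 ≤ 2 / E ^ 2 := by positivity
  unfold hFun
  nlinarith [mul_le_mul_of_nonneg_left h2 h3]

/-- Integrate h(s) ≤ s h(t)/t over [0, t]; this is the condition on h required by Herbst's argument.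
-/
theorem integral_hFun_le {t : ℝ} (ht : 0 ≤ t) (hI : ∀ s ∈ Set.Icc 0 t, HFunIntegrable ν s) :
    ∫ s in (0 : ℝ)..t, hFun ν S E s ≤ t * hFun ν S E t / 2 := by
  rcases ht.eq_or_lt with rfl | ht0
  · simp
  have hit := hI t ⟨ht, le_rfl⟩
  have hc : ContinuousOn (hFun ν S E) (Set.uIcc 0 t) := by
    rw [Set.uIcc_of_le ht]
    exact continuousOn_hFun hit
  calc ∫ s in (0 : ℝ)..t, hFun ν S E s ≤ ∫ s in (0 : ℝ)..t, s * (hFun ν S E t / t) := by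
        refine intervalIntegral.integral_mono_on ht hc.intervalIntegrable
          (intervalIntegral.intervalIntegrable_id.mul_const _) fun s hs => ?_
        rw [← mul_div_assoc, le_div_iff₀ ht0, mul_comm]
        exact mul_hFun_le hs.1 hs.2 (hI s hs) hit
    _ = _ := by
        rw [intervalIntegral.integral_mul_const, integral_id]
        field_simp
        ring

theorem IsLevyMeasure.exists_coord_ne_zero (h : IsLevyMeasure ν) :
    ∃ k : Fin d, ν {u | u k ≠ 0} ≠ 0 := by
  by_contra! hk
  refine h.ne_zero (Measure.measure_univ_eq_zero.1 ?_)
  have : (Set.univ : Set (EuclideanSpace ℝ (Fin d))) ⊆ {0} ∪ ⋃ k : Fin d, {u | u k ≠ 0} := by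
    intro u _
    by_cases hu : u = 0
    · exact Or.inl hu
    · right
      by_contra hne
      refine hu ?_
      ext k
      simpa using fun h => hne (Set.mem_iUnion.2 ⟨k, h⟩)
  exact measure_mono_null this (measure_union_null h.zero_atom (measure_iUnion_null hk))

theorem integral_axis_mono {m : Measure ℝ} {w : ℝ → ℝ} (hw0 : ∀ u, 0 ≤ w u) {s t : ℝ}
    (hst : s ≤ t)
    (his : Integrable (fun u => w u * (Real.exp (s * |u|) - 1)) m)
    (hit : Integrable (fun u => w u * (Real.exp (t * |u|) - 1)) m) :
    ∫ u, w u * (Real.exp (s * |u|) - 1) ∂m ≤ ∫ u, w u * (Real.exp (t * |u|) - 1) ∂m :=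
  integral_mono his hit fun u => by
    have := hw0 u
    simp only
    gcongr

theorem integral_axis_lt {k : Fin d} (hk : ν {u | u k ≠ 0} ≠ 0) {s t : ℝ} (hst : s < t)
    (his : HFunIntegrable ν s) (hit : HFunIntegrable ν t) :
    ∫ u, |u| * (Real.exp (s * |u|) - 1) ∂(axisLevyMeasure ν k) <
      ∫ u, |u| * (Real.exp (t * |u|) - 1) ∂(axisLevyMeasure ν k) := by
  have m1 : ∀ t, Measurable fun u : ℝ => |u| * (Real.exp (t * |u|) - 1) := fun t => by fun_prop
  rw [integral_axisLevyMeasure (m1 s) (by simp), integral_axisLevyMeasure (m1 t) (by simp),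
    ← sub_pos]
  have is := (integrable_axisLevyMeasure_iff (m1 s) (by simp)).1 (his k).1
  have it := (integrable_axisLevyMeasure_iff (m1 t) (by simp)).1 (hit k).1
  rw [← integral_sub it is]
  refine (integral_pos_iff_support_of_nonneg ?_ (it.sub is)).2 ?_
  swap
  · refine (pos_iff_ne_zero.2 hk).trans_le (measure_mono fun u (hu : u k ≠ 0) => ?_)
    have hu' : 0 < |u k| := abs_pos.2 hu
    have : Real.exp (s * |u k|) < Real.exp (t * |u k|) := by gcongr
    have h2 := mul_pos hu' (sub_pos.2 this)
    refine ne_of_gt ?_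
    simp only [Pi.sub_apply]
    linarith
  · intro u
    have : Real.exp (s * |u k|) ≤ Real.exp (t * |u k|) := by gcongr
    have h2 := mul_nonneg (abs_nonneg (u k)) (sub_nonneg.2 this)
    simp only [Pi.zero_apply, Pi.sub_apply]
    linarith

/-- Strictness must come from the maximum, since every Π_S e_k may vanish. If the axis attaining it
at s carries no mass, the maximum there is 0 and any charged axis exceeds it at t. -/
theorem IsLevyMeasure.hFun_lt_hFun (h : IsLevyMeasure ν) {s t : ℝ} (hs : 0 ≤ s) (hst : s < t)
    (his : HFunIntegrable ν s) (hit : HFunIntegrable ν t) : hFun ν S E s < hFun ν S E t := by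
  obtain ⟨k₀, hk₀⟩ := h.exists_coord_ne_zero
  have hne : Nonempty (Fin d) := ⟨k₀⟩
  set B : ℝ → Fin d → ℝ :=
    fun t k => ∫ u, |u| * (Real.exp (t * |u|) - 1) ∂(axisLevyMeasure ν k) with hB
  have hle : ∀ t k, B t k ≤ ⨆ k, B t k := fun t k => le_ciSup (Set.finite_range (B t)).bddAbove k
  have hsup : ⨆ k, B s k < ⨆ k, B t k := by
    obtain ⟨k, hk⟩ := exists_eq_ciSup_of_finite (f := B s)
    rw [← hk]
    by_cases hzero : ν {u | u k ≠ 0} = 0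
    · have : B s k = 0 := by
        have hax : axisLevyMeasure ν k = 0 := by
          rw [axisLevyMeasure, Measure.restrict_eq_zero.2 hzero, Measure.map_zero]
        simp [hB, hax]
      rw [this]
      exact ((integral_axis_nonneg k₀ hs).trans_lt (integral_axis_lt hk₀ hst his hit)).trans_le
        (hle t k₀)
    · exact (integral_axis_lt hzero hst his hit).trans_le (hle t k)
  have hsum : ∑ k : Fin d, ‖S.starProjection (EuclideanSpace.single k (1 : ℝ))‖ ^ 4 *
        ∫ u, |u| ^ 3 * (Real.exp (s * |u|) - 1) ∂(axisLevyMeasure ν k) ≤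
      ∑ k : Fin d, ‖S.starProjection (EuclideanSpace.single k (1 : ℝ))‖ ^ 4 *
        ∫ u, |u| ^ 3 * (Real.exp (t * |u|) - 1) ∂(axisLevyMeasure ν k) := by
    refine Finset.sum_le_sum fun k _ => mul_le_mul_of_nonneg_left ?_ (by positivity)
    exact integral_axis_mono (fun u => by positivity) hst.le (his k).2 (hit k).2
  unfold hFun
  refine add_lt_add_of_lt_of_le (by gcongr) ?_
  gcongr

end HFunction

/-! ### The inverse function and Young's equality -/

section Inverse

variable {h : ℝ → ℝ} {M : EReal}

theorem exists_gt_mem_realIco {t : ℝ} (ht : t ∈ realIco M) : ∃ t' ∈ realIco M, t < t' := by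
  obtain ⟨t', h1, h2⟩ := EReal.lt_iff_exists_real_btwn.1 ht.2
  have h1' : t < t' := EReal.coe_lt_coe_iff.1 h1
  exact ⟨t', ⟨ht.1.trans h1'.le, h2⟩, h1'⟩

theorem mem_realIco_of_le {s t : ℝ} (hs : 0 ≤ s) (hst : s ≤ t) (ht : t ∈ realIco M) :
    s ∈ realIco M :=
  ⟨hs, (EReal.coe_le_coe_iff.2 hst).trans_lt ht.2⟩

/-- Surjectivity is the intermediate value theorem on [0, t] for some t with h(t) > y. The supremum
is not attained, because `realIco M` has no largest element and h is strictly increasing. -/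
theorem bijOn_realIco (h0 : h 0 = 0) (hmono : StrictMonoOn h (realIco M))
    (hcont : ∀ t ∈ realIco M, ContinuousOn h (Set.Icc 0 t)) :
    Set.BijOn h (realIco M) (realIco (leftLimOn h M)) := by
  refine ⟨fun t ht => ⟨?_, ?_⟩, hmono.injOn, fun y hy => ?_⟩
  · rw [← h0]
    exact hmono.monotoneOn (mem_realIco_of_le le_rfl ht.1 ht) ht ht.1
  · obtain ⟨t', ht', hlt⟩ := exists_gt_mem_realIco ht
    exact (EReal.coe_lt_coe_iff.2 (hmono ht ht' hlt)).trans_le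
      (le_iSup₂ (f := fun t (_ : t ∈ realIco M) => (h t : EReal)) t' ht')
  · obtain ⟨t, hlt⟩ := lt_iSup_iff.1 hy.2
    obtain ⟨ht, hlt⟩ := lt_iSup_iff.1 hlt
    obtain ⟨s, hs, rfl⟩ := intermediate_value_Icc ht.1 (hcont t ht)
      ⟨h0.symm ▸ hy.1, (EReal.coe_lt_coe_iff.1 hlt).le⟩
    exact ⟨s, mem_realIco_of_le hs.1 hs.2 ht, rfl⟩

/-- The case of equality in Young's inequality: `∫₀^x g = ∫₀^T (x - h)` if `g` is the inverse of the
increasing function `h` and `h(T) = x`. -/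
theorem integral_inverse_eq {g : ℝ → ℝ} {x T : ℝ} (hx : 0 ≤ x) (hT : 0 ≤ T)
    (hc : ContinuousOn h (Set.Icc 0 T)) (hh : ∀ t ∈ Set.Icc 0 T, h t ∈ Set.Icc 0 x)
    (hg : MonotoneOn g (Set.Icc 0 x)) (hgT : ∀ s ∈ Set.Icc 0 x, g s ∈ Set.Icc 0 T)
    (hiff : ∀ s ∈ Set.Icc 0 x, ∀ t ∈ Set.Icc 0 T, h t < s ↔ t < g s) :
    ∫ s in (0 : ℝ)..x, g s = ∫ t in (0 : ℝ)..T, (x - h t) := by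
  set μ : Measure ℝ := volume.restrict (Set.Ioc 0 x) with hμ
  set m : Measure ℝ := volume.restrict (Set.Ioc 0 T) with hm
  have hcI : ContinuousOn h (Set.Ioc 0 T) := hc.mono Set.Ioc_subset_Icc_self
  have hhm : AEMeasurable h m := hcI.aemeasurable measurableSet_Ioc
  have hnull : NullMeasurableSet {z : ℝ × ℝ | h z.2 < z.1} (μ.prod m) :=
    nullMeasurableSet_lt hhm.comp_snd measurable_fst.aemeasurable
  -- Both integrals are the area of {h(t) < s} in the rectangle, sliced in t or in s.
  have hswap := lintegral_lintegral_swap (μ := μ) (ν := m)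
    (f := fun s t => Set.indicator {z : ℝ × ℝ | h z.2 < z.1} (1 : ℝ × ℝ → ENNReal) (s, t))
    ((aemeasurable_const (b := (1 : ENNReal))).indicator₀ hnull)
  have e1 : ∫⁻ s, ∫⁻ t, Set.indicator {z : ℝ × ℝ | h z.2 < z.1} (1 : ℝ × ℝ → ENNReal) (s, t) ∂m ∂μ =
      ∫⁻ s in Set.Ioc 0 x, ENNReal.ofReal (g s) := by
    refine setLIntegral_congr_fun measurableSet_Ioc fun s hs => ?_
    have hs' := Set.Ioc_subset_Icc_self hs
    have : ∫⁻ t, Set.indicator {z : ℝ × ℝ | h z.2 < z.1} (1 : ℝ × ℝ → ENNReal) (s, t) ∂m =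
        ∫⁻ t in Set.Ioc 0 T, Set.indicator (Set.Iio (g s)) 1 t := by
      refine setLIntegral_congr_fun measurableSet_Ioc fun t ht => ?_
      have := hiff s hs' t (Set.Ioc_subset_Icc_self ht)
      simp only [Set.indicator_apply, Set.mem_Iio, Pi.one_apply, ← this]
      rfl
    rw [this, lintegral_indicator_one measurableSet_Iio, Measure.restrict_apply measurableSet_Iio]
    have hset : Set.Iio (g s) ∩ Set.Ioc 0 T = Set.Ioo 0 (g s) := by
      ext t
      constructor
      · exact fun ht => ⟨ht.2.1, ht.1⟩
      · exact fun ht => ⟨ht.2, ht.1, ht.2.le.trans (hgT s hs').2⟩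
    rw [hset, Real.volume_Ioo, sub_zero]
  have e2 : ∫⁻ t, ∫⁻ s, Set.indicator {z : ℝ × ℝ | h z.2 < z.1} (1 : ℝ × ℝ → ENNReal) (s, t) ∂μ ∂m =
      ∫⁻ t in Set.Ioc 0 T, ENNReal.ofReal (x - h t) := by
    refine setLIntegral_congr_fun measurableSet_Ioc fun t ht => ?_
    have ht' := hh t (Set.Ioc_subset_Icc_self ht)
    have : ∫⁻ s, Set.indicator {z : ℝ × ℝ | h z.2 < z.1} (1 : ℝ × ℝ → ENNReal) (s, t) ∂μ =
        ∫⁻ s in Set.Ioc 0 x, Set.indicator (Set.Ioi (h t)) 1 s := by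
      refine setLIntegral_congr_fun measurableSet_Ioc fun s _ => ?_
      simp only [Set.indicator_apply, Set.mem_Ioi, Pi.one_apply]
      rfl
    rw [this, lintegral_indicator_one measurableSet_Ioi, Measure.restrict_apply measurableSet_Ioi]
    have hset : Set.Ioi (h t) ∩ Set.Ioc 0 x = Set.Ioc (h t) x := by
      ext s
      constructor
      · exact fun hs => ⟨hs.1, hs.2.2⟩
      · exact fun hs => ⟨hs.1, ht'.1.trans_lt hs.1, hs.2⟩
    rw [hset, Real.volume_Ioc]
  rw [e1, e2] at hswap
  rw [intervalIntegral.integral_of_le hx, intervalIntegral.integral_of_le hT,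
    integral_eq_lintegral_of_nonneg_ae, integral_eq_lintegral_of_nonneg_ae, hswap]
  · exact (ae_restrict_iff' measurableSet_Ioc).2 (Filter.Eventually.of_forall fun t ht =>
      sub_nonneg.2 (hh t (Set.Ioc_subset_Icc_self ht)).2)
  · exact (continuousOn_const.sub hcI).aestronglyMeasurable measurableSet_Ioc
  · exact (ae_restrict_iff' measurableSet_Ioc).2 (Filter.Eventually.of_forall fun s hs =>
      (hgT s (Set.Ioc_subset_Icc_self hs)).1)
  · exact (aemeasurable_restrict_of_monotoneOn measurableSet_Ioc
      (hg.mono Set.Ioc_subset_Icc_self)).aestronglyMeasurable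

/-- Legendre duality for the inverse of an increasing function. -/
theorem integral_inverseOn (h0 : h 0 = 0) (hmono : StrictMonoOn h (realIco M))
    (hcont : ∀ t ∈ realIco M, ContinuousOn h (Set.Icc 0 t)) {x : ℝ} (hx : 0 < x) (hlt : (x : EReal) < leftLimOn h M) :
    ∃ T ∈ realIco M, 0 < T ∧ IntervalIntegrable (inverseOn h M) volume 0 x ∧
      ∫ s in (0 : ℝ)..x, inverseOn h M s = T * x - ∫ t in (0 : ℝ)..T, h t := by
  have hbij := bijOn_realIco h0 hmono hcont
  have hmemx : ∀ s ∈ Set.Icc 0 x, s ∈ realIco (leftLimOn h M) := fun s hs =>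
    ⟨hs.1, (EReal.coe_le_coe_iff.2 hs.2).trans_lt hlt⟩
  have hinv : ∀ s ∈ Set.Icc 0 x, inverseOn h M s ∈ realIco M ∧ h (inverseOn h M s) = s :=
    fun s hs => by
      have := hbij.surjOn (hmemx s hs)
      exact ⟨Function.invFunOn_mem this, Function.invFunOn_eq this⟩
  have hxx : x ∈ Set.Icc 0 x := ⟨hx.le, le_rfl⟩
  obtain ⟨hTM, hTx⟩ := hinv x hxx
  -- This T maximizes t x - ∫₀ᵗ h on [0, M), hence is the optimal Chernoff parameter.
  set T := inverseOn h M x with hT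
  have hT0 : 0 < T := by
    refine lt_of_le_of_ne hTM.1 fun h' => ?_
    rw [← h', h0] at hTx
    exact hx.ne hTx
  have hmemT : ∀ t ∈ Set.Icc 0 T, t ∈ realIco M := fun t ht => mem_realIco_of_le ht.1 ht.2 hTM
  have hg : MonotoneOn (inverseOn h M) (Set.Icc 0 x) := fun a ha b hb hab => by
    rw [← hmono.le_iff_le (hinv a ha).1 (hinv b hb).1, (hinv a ha).2, (hinv b hb).2]
    exact hab
  have hgi : IntervalIntegrable (inverseOn h M) volume 0 x :=
    MonotoneOn.intervalIntegrable (by rwa [Set.uIcc_of_le hx.le])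
  have hc := hcont T hTM
  have hhi : IntervalIntegrable h volume 0 T :=
    ContinuousOn.intervalIntegrable (by rwa [Set.uIcc_of_le hT0.le])
  refine ⟨T, hTM, hT0, hgi, ?_⟩
  rw [integral_inverse_eq hx.le hT0.le hc (fun t ht => ⟨?_, ?_⟩) hg
    (fun s hs => ⟨(hinv s hs).1.1, hg hs hxx hs.2⟩) (fun s hs t ht => ?_),
    intervalIntegral.integral_sub intervalIntegrable_const hhi]
  · simp
  · rw [← h0]
    exact hmono.monotoneOn (hmemT 0 ⟨le_rfl, hT0.le⟩) (hmemT t ht) ht.1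
  · rw [← hTx]
    exact hmono.monotoneOn (hmemT t ht) hTM ht.2
  · conv_lhs => rw [← (hinv s hs).2]
    exact hmono.lt_iff_lt (hmemT t ht) (hinv s hs).1

end Inverse

/-! ### Integrability and truncation of the smoothed norm -/

section Deviation

variable {Ω : Type*} [MeasurableSpace Ω] {P : Measure Ω} {d : ℕ}
  {X : Ω → EuclideanSpace ℝ (Fin d)} {γ : EuclideanSpace ℝ (Fin d)}
  {ν : Measure (EuclideanSpace ℝ (Fin d))} {S : Submodule ℝ (EuclideanSpace ℝ (Fin d))} {E : ℝ}

theorem exists_exp_moment {t : ℝ} (ht : (t : EReal) < expMomentBound P X) :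
    ∃ t', t < t' ∧ 0 < t' ∧ ∀ k, Integrable (fun ω => Real.exp (t' * |X ω k|)) P := by
  obtain ⟨_, ⟨t', ht', rfl⟩, hlt⟩ := lt_sSup_iff.1 ht
  exact ⟨t', EReal.coe_lt_coe_iff.1 hlt, ht'.1, ht'.2⟩

theorem integrable_norm_of_exp_moment (hXm : AEMeasurable X P) {t : ℝ} (ht : 0 < t)
    (hexp : ∀ k, Integrable (fun ω => Real.exp (t * |X ω k|)) P) :
    Integrable (fun ω => ‖X ω‖) P := by
  have hdom : Integrable (fun ω => ∑ k, t⁻¹ * Real.exp (t * |X ω k|)) P :=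
    integrable_finsetSum _ fun k _ => (hexp k).const_mul _
  refine hdom.mono' hXm.norm.aestronglyMeasurable (Filter.Eventually.of_forall fun ω => ?_)
  rw [norm_norm]
  calc ‖X ω‖ = ‖∑ k, X ω k • EuclideanSpace.single k (1 : ℝ)‖ := by
        congr 1
        ext j
        simp [Finset.sum_apply, Pi.single_apply]
    _ ≤ ∑ k, ‖X ω k • EuclideanSpace.single k (1 : ℝ)‖ := norm_sum_le _ _
    _ ≤ ∑ k, t⁻¹ * Real.exp (t * |X ω k|) := by
        refine Finset.sum_le_sum fun k _ => ?_
        rw [norm_smul, PiLp.norm_single, norm_one, mul_one, Real.norm_eq_abs,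
          ← div_eq_inv_mul, le_div_iff₀ ht]
        linarith [Real.add_one_le_exp (t * |X ω k|)]

variable [IsProbabilityMeasure P]

theorem IsIDVector.hFunIntegrable (hX : IsIDVector P X γ ν) {t : ℝ}
    (ht : t ∈ realIco (expMomentBound P X)) : HFunIntegrable ν t := by
  obtain ⟨t', hlt, hpos, hexp⟩ := exists_exp_moment ht.2
  exact hX.levy.hFunIntegrable ht.1 hlt fun k => hX.integrableOn_exp_bigJumps hpos.le (hexp k)

theorem measureReal_ge_le_exp {f : Ω → ℝ} (hf : AEMeasurable f P) {C : ℝ} (hC : ∀ ω, |f ω| ≤ C)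
    {T a : ℝ} (hT : 0 < T) :
    P.real {ω | a ≤ f ω} ≤ Real.exp (-T * a) * ∫ ω, Real.exp (T * f ω) ∂P := by
  refine measure_ge_le_exp_mul_mgf a hT.le ?_
  exact Integrable.of_bound (by fun_prop) (Real.exp (T * C)) (Filter.Eventually.of_forall fun ω =>
    abs_exp_le (by rw [abs_mul, abs_of_pos hT]; gcongr; exact hC ω))

/-- The smoothed norm of the projection on `S`, truncated at level `n`. -/
noncomputable def truncSmoothNorm (S : Submodule ℝ (EuclideanSpace ℝ (Fin d))) (E : ℝ) (n : ℕ)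
    (x : EuclideanSpace ℝ (Fin d)) : ℝ :=
  min (smoothNorm E (S.starProjection x)) n

theorem continuous_truncSmoothNorm (n : ℕ) : Continuous (truncSmoothNorm S E n) := by
  unfold truncSmoothNorm
  fun_prop

theorem abs_truncSmoothNorm_le (n : ℕ) (x : EuclideanSpace ℝ (Fin d)) :
    |truncSmoothNorm S E n x| ≤ n := by
  rw [truncSmoothNorm, abs_of_nonneg (le_min (smoothNorm_nonneg E _) (Nat.cast_nonneg n))]
  exact min_le_right _ _

theorem abs_truncSmoothNorm_sub_le (n : ℕ) (x u : EuclideanSpace ℝ (Fin d)) :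
    |truncSmoothNorm S E n (x + u) - truncSmoothNorm S E n x| ≤
      |smoothNorm E (S.starProjection (x + u)) - smoothNorm E (S.starProjection x)| := by
  have := abs_min_sub_min_le_max (smoothNorm E (S.starProjection (x + u))) (n : ℝ)
    (smoothNorm E (S.starProjection x)) (n : ℝ)
  simpa [truncSmoothNorm] using this

theorem integrable_smoothNorm (hXm : AEMeasurable X P) (hE : 0 < E)
    (hint : Integrable (fun ω => ‖S.starProjection (X ω)‖) P) :
    Integrable (fun ω => smoothNorm E (S.starProjection (X ω))) P := by
  refine (hint.add (integrable_const E)).mono' ?_ (Filter.Eventually.of_forall fun ω => ?_)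
  · exact ((by fun_prop : Measurable fun x : EuclideanSpace ℝ (Fin d) =>
      smoothNorm E (S.starProjection x)).comp_aemeasurable hXm).aestronglyMeasurable
  · rw [Real.norm_of_nonneg (smoothNorm_nonneg E _)]
    exact smoothNorm_le hE.le _

theorem tendsto_integral_truncSmoothNorm (hXm : AEMeasurable X P) (hE : 0 < E)
    (hint : Integrable (fun ω => ‖S.starProjection (X ω)‖) P) :
    Filter.Tendsto (fun n : ℕ => ∫ ω, truncSmoothNorm S E n (X ω) ∂P) Filter.atTop
      (nhds (∫ ω, smoothNorm E (S.starProjection (X ω)) ∂P)) := by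
  refine tendsto_integral_of_dominated_convergence _ (fun n => ?_)
    (integrable_smoothNorm hXm hE hint) (fun n => Filter.Eventually.of_forall fun ω => ?_)
    (Filter.Eventually.of_forall fun ω => ?_)
  · exact ((continuous_truncSmoothNorm n).measurable.comp_aemeasurable hXm).aestronglyMeasurable
  · rw [truncSmoothNorm, Real.norm_of_nonneg (le_min (smoothNorm_nonneg E _) (Nat.cast_nonneg n))]
    exact min_le_left _ _
  · obtain ⟨N, hN⟩ := exists_nat_ge (smoothNorm E (S.starProjection (X ω)))
    refine tendsto_const_nhds.congr' ?_
    filter_upwards [Filter.eventually_ge_atTop N] with n hn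
    rw [truncSmoothNorm, min_eq_left (hN.trans (by exact_mod_cast hn))]

end Deviation

/-! ### Chernoff bounds and the deviation inequalities -/

section Main

variable {Ω : Type*} [MeasurableSpace Ω] {P : Measure Ω} [IsProbabilityMeasure P] {d : ℕ}
  {X : Ω → EuclideanSpace ℝ (Fin d)} {γ : EuclideanSpace ℝ (Fin d)}
  {ν : Measure (EuclideanSpace ℝ (Fin d))} {S : Submodule ℝ (EuclideanSpace ℝ (Fin d))} {E : ℝ}

theorem IsIDVector.measureReal_ge_le (hX : IsIDVector P X γ ν) (hax : OnAxes ν) (hE : 0 < E)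
    {T : ℝ} (hT : 0 < T) (hTM : T ∈ realIco (expMomentBound P X))
    {f : EuclideanSpace ℝ (Fin d) → ℝ} (hfc : Continuous f) {C : ℝ} (hC : ∀ x, |f x| ≤ C)
    (hf : ∀ x u, |f (x + u) - f x| ≤
      |smoothNorm E (S.starProjection (x + u)) - smoothNorm E (S.starProjection x)|) (a : ℝ) :
    P.real {ω | a ≤ f (X ω)} ≤ Real.exp (-T * a) *
      Real.exp (T * ∫ ω, f (X ω) ∂P + ∫ s in (0 : ℝ)..T, hFun ν S E s) := by
  have hI : ∀ t ∈ Set.Icc 0 T, HFunIntegrable ν t := fun t ht =>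
    hX.hFunIntegrable (mem_realIco_of_le ht.1 ht.2 hTM)
  refine (measureReal_ge_le_exp (hfc.measurable.comp_aemeasurable hX.aemeasurable)
    (fun ω => hC (X ω)) hT).trans ?_
  gcongr
  exact hX.integral_exp_le hax hE hT hI (continuousOn_hFun (hX.hFunIntegrable hTM))
    (fun t ht => integral_hFun_le ht.1 fun s hs => hI s ⟨hs.1, hs.2.trans ht.2⟩) hfc hC hf

/-- One truncation level above the threshold suffices: the event is unaffected and truncation only
lowers the mean, which helps here. -/
theorem IsIDVector.upper_deviation (hX : IsIDVector P X γ ν) (hax : OnAxes ν) (hE : 0 < E)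
    {T : ℝ} (hT : 0 < T) (hTM : T ∈ realIco (expMomentBound P X))
    (hint : Integrable (fun ω => ‖S.starProjection (X ω)‖) P) (x : ℝ) :
    P.real {ω | (∫ ω', ‖S.starProjection (X ω')‖ ∂P) + E + x ≤ ‖S.starProjection (X ω)‖} ≤
      Real.exp (-(T * x - ∫ s in (0 : ℝ)..T, hFun ν S E s)) := by
  have hfi := integrable_smoothNorm hX.aemeasurable hE hint
  have hmean : ∫ ω, smoothNorm E (S.starProjection (X ω)) ∂P ≤
      (∫ ω, ‖S.starProjection (X ω)‖ ∂P) + E := by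
    have := integral_mono hfi (hint.add (integrable_const E)) fun ω => smoothNorm_le hE.le _
    simpa [integral_add hint (integrable_const E)] using this
  obtain ⟨n, hn⟩ := exists_nat_ge ((∫ ω, ‖S.starProjection (X ω)‖ ∂P) + E + x)
  have htr : ∫ ω, truncSmoothNorm S E n (X ω) ∂P ≤
      ∫ ω, smoothNorm E (S.starProjection (X ω)) ∂P := by
    refine integral_mono_of_nonneg (Filter.Eventually.of_forall fun ω =>
      le_min (smoothNorm_nonneg E _) (Nat.cast_nonneg n)) hfi
      (Filter.Eventually.of_forall fun ω => min_le_left _ _)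
  have key := hX.measureReal_ge_le hax hE hT hTM (continuous_truncSmoothNorm n)
    (abs_truncSmoothNorm_le n) (abs_truncSmoothNorm_sub_le (S := S) n)
    ((∫ ω, truncSmoothNorm S E n (X ω) ∂P) + x)
  refine (measureReal_mono fun ω hω => ?_).trans (key.trans_eq ?_)
  · have hω' : (∫ ω', ‖S.starProjection (X ω')‖ ∂P) + E + x ≤ ‖S.starProjection (X ω)‖ := hω
    change (∫ ω, truncSmoothNorm S E n (X ω) ∂P) + x ≤ min (smoothNorm E _) (n : ℝ)
    exact le_min (by linarith [norm_le_smoothNorm E (S.starProjection (X ω))]) (by linarith)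
  · rw [← Real.exp_add]
    ring_nf

/-- Applied to the negative of the truncated smoothed norm. The lowered mean now works against the
bound, so the truncation level is sent to infinity. -/
theorem IsIDVector.lower_deviation (hX : IsIDVector P X γ ν) (hax : OnAxes ν) (hE : 0 < E)
    {T : ℝ} (hT : 0 < T) (hTM : T ∈ realIco (expMomentBound P X))
    (hint : Integrable (fun ω => ‖S.starProjection (X ω)‖) P) (x : ℝ) :
    P.real {ω | ‖S.starProjection (X ω)‖ ≤ (∫ ω', ‖S.starProjection (X ω')‖ ∂P) - E - x} ≤
      Real.exp (-(T * x - ∫ s in (0 : ℝ)..T, hFun ν S E s)) := by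
  have hfi := integrable_smoothNorm hX.aemeasurable hE hint
  set m := ∫ ω, smoothNorm E (S.starProjection (X ω)) ∂P with hm
  have hmean : ∫ ω, ‖S.starProjection (X ω)‖ ∂P ≤ m :=
    integral_mono hint hfi fun ω => norm_le_smoothNorm E _
  have hn : ∀ n : ℕ,
      P.real {ω | ‖S.starProjection (X ω)‖ ≤ (∫ ω', ‖S.starProjection (X ω')‖ ∂P) - E - x} ≤
      Real.exp (T * (m - ∫ ω, truncSmoothNorm S E n (X ω) ∂P) -
        (T * x - ∫ s in (0 : ℝ)..T, hFun ν S E s)) := fun n => by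
    have key := hX.measureReal_ge_le hax hE hT hTM (f := fun x => -truncSmoothNorm S E n x)
      (continuous_truncSmoothNorm n).neg
      (fun x => by rw [abs_neg]; exact abs_truncSmoothNorm_le n x)
      (fun x u => by
        rw [neg_sub_neg, abs_sub_comm]
        exact abs_truncSmoothNorm_sub_le (S := S) n x u) (x - m)
    refine (measureReal_mono fun ω hω => ?_).trans (key.trans_eq ?_)
    · have hω' : ‖S.starProjection (X ω)‖ ≤ (∫ ω', ‖S.starProjection (X ω')‖ ∂P) - E - x := hω
      have h1 : truncSmoothNorm S E n (X ω) ≤ smoothNorm E (S.starProjection (X ω)) :=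
        min_le_left _ _
      have h2 := smoothNorm_le hE.le (S.starProjection (X ω))
      change x - m ≤ -truncSmoothNorm S E n (X ω)
      linarith
    · rw [← Real.exp_add, integral_neg]
      ring_nf
  have hlim := (tendsto_integral_truncSmoothNorm hX.aemeasurable hE hint).const_sub m
  have hlim2 := (Real.continuous_exp.tendsto _).comp ((hlim.const_mul T).sub_const
    (T * x - ∫ s in (0 : ℝ)..T, hFun ν S E s))
  rw [← hm, sub_self, mul_zero, zero_sub] at hlim2
  exact ge_of_tendsto' hlim2 hn

end Main

theorem corollary3 {Ω : Type*} [MeasurableSpace Ω] (P : Measure Ω) [IsProbabilityMeasure P]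
    {d : ℕ} (X : Ω → EuclideanSpace ℝ (Fin d)) (γ : EuclideanSpace ℝ (Fin d))
    (ν : Measure (EuclideanSpace ℝ (Fin d))) (hX : IsIDVector P X γ ν)
    (hindep : iIndepFun (fun (k : Fin d) (ω : Ω) => X ω k) P)
    (S : Submodule ℝ (EuclideanSpace ℝ (Fin d))) (E : ℝ) (hE : 0 < E) :
    -- all the integrals in the definition of `h` are finite on `[0, M)`
    (∀ t ∈ realIco (expMomentBound P X), ∀ k : Fin d,
      Integrable (fun u : ℝ => |u| * (Real.exp (t * |u|) - 1)) (axisLevyMeasure ν k) ∧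
      Integrable (fun u : ℝ => |u| ^ 3 * (Real.exp (t * |u|) - 1)) (axisLevyMeasure ν k)) ∧
    -- `h` is an increasing bijection from `[0, M)` onto `[0, h(M⁻))`
    StrictMonoOn (hFun ν S E) (realIco (expMomentBound P X)) ∧
    Set.BijOn (hFun ν S E) (realIco (expMomentBound P X))
      (realIco (leftLimOn (hFun ν S E) (expMomentBound P X))) ∧
    -- the two deviation inequalities
    ∀ x : ℝ, 0 < x → (x : EReal) < leftLimOn (hFun ν S E) (expMomentBound P X) →
      Integrable (fun ω => ‖S.starProjection (X ω)‖) P ∧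
      IntervalIntegrable (inverseOn (hFun ν S E) (expMomentBound P X)) volume 0 x ∧
      P.real {ω | (∫ ω', ‖S.starProjection (X ω')‖ ∂P) + E + x ≤ ‖S.starProjection (X ω)‖} ≤
        Real.exp (-∫ s in (0 : ℝ)..x, inverseOn (hFun ν S E) (expMomentBound P X) s) ∧
      P.real {ω | ‖S.starProjection (X ω)‖ ≤ (∫ ω', ‖S.starProjection (X ω')‖ ∂P) - E - x} ≤
        Real.exp (-∫ s in (0 : ℝ)..x, inverseOn (hFun ν S E) (expMomentBound P X) s) := by
  have hax := hX.onAxes hindep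
  set M := expMomentBound P X with hM
  have hI : ∀ t ∈ realIco M, HFunIntegrable ν t := fun t ht => hX.hFunIntegrable ht
  have hmono : StrictMonoOn (hFun ν S E) (realIco M) := fun s hs t ht hst =>
    hX.levy.hFun_lt_hFun hs.1 hst (hI s hs) (hI t ht)
  have hcont : ∀ t ∈ realIco M, ContinuousOn (hFun ν S E) (Set.Icc 0 t) := fun t ht =>
    continuousOn_hFun (hI t ht)
  refine ⟨hI, hmono, bijOn_realIco hFun_zero hmono hcont, fun x hx hlt => ?_⟩
  obtain ⟨T, hTM, hT, hgi, hyoung⟩ := integral_inverseOn hFun_zero hmono hcont hx hlt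
  obtain ⟨t', -, ht', hexp⟩ := exists_exp_moment hTM.2
  have hint : Integrable (fun ω => ‖S.starProjection (X ω)‖) P := by
    refine (integrable_norm_of_exp_moment hX.aemeasurable ht' hexp).mono' ?_
      (Filter.Eventually.of_forall fun ω => ?_)
    · exact ((by fun_prop : Measurable fun x : EuclideanSpace ℝ (Fin d) =>
        ‖S.starProjection x‖).comp_aemeasurable hX.aemeasurable).aestronglyMeasurable
    · rw [norm_norm]
      exact S.norm_starProjection_apply_le _
  rw [hyoung]
  exact ⟨hint, hgi, hX.upper_deviation hax hE hT hTM hint x,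
    hX.lower_deviation hax hE hT hTM hint x⟩
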